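/- Let $d\ge 1$, let $\mathcal O\subset\mathbb R^d$ be a bounded domain with smooth boundary, let $1<p\le 2$, and let $\nu$ be a Lévy measure on $\mathbb R$. Let $(\Omega,\mathcal F,\mathbb P)$ be a complete probability space and let $\eta$ be a space-time Poissonian white noise on $\mathcal O$ with jump size intensity $\nu$: a measurable map $\omega\mapsto\eta_\omega$ into the $\{0,1,2,\dots\}\cup\{\infty\}$-valued measures on $(\mathcal O\times[0,\infty))\times\mathbb R$ such that, with $\sigma$ the Lebesgue measure on $\mathcal O\times[0,\infty)$, for Borel sets $A\subset\mathcal O\times[0,\infty)$ and $B\subset\mathbb R$ with $\sigma(A)\nu(B)<\infty$ the variable $\eta(A\times B)$ is Poisson distributed with parameter $\sigma(A)\nu(B)$, and the values of $\eta$ on any finite family of pairwise disjoint sets of the form $A\times B$ are independent. Let $Z=B^{d/p-d}_{p,\infty}(\bar{\mathcal O})$ be the space of all $f\in B^{d/p-d}_{p,\infty}(\mathbb R^d)$ with $\operatorname{supp} f\subset\bar{\mathcal O}$, and let $\mathcal B(Z)$ be the Borel $\sigma$-field of the weak-$*$ topology of $Z$ (the topology of convergence against test functions). Then $\zeta\delta_\xi\in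 Z$ for all $\zeta\in\mathbb R$, $\xi\in\mathcal O$, the map $(\xi,\zeta)\mapsto\zeta\delta_\xi$ from $\mathcal O\times\mathbb R$ to $(Z,\mathcal B(Z))$ is measurable, and the random measure $\eta_Z$ on $Z\times[0,\infty)$, defined as the image of $\eta$ under $((\xi,t),\zeta)\mapsto(\zeta\delta_\xi,t)$, so that $$\eta_Z(B\times I)=\int_I\iint_{\mathbb R\times\mathcal O}1_B(\zeta\delta_\xi)\,\eta(d\xi,d\zeta,dt),\qquad B\in\mathcal B(Z),\ I\in\mathcal B([0,\infty)),$$ is a time-homogeneous Poisson random measure on $Z$ with intensity $$\hat\nu(B)=\int_{\mathbb R}\int_{\mathcal O}1_B(\zeta\delta_\xi)\,d\xi\,\nu(d\zeta),\qquad B\in\mathcal B(Z).$$ That is: $\eta_Z$ is a measurable random measure with values in $\{0,1,2,\dots\}\cup\{\infty\}$; for every measurable $C\subset Z\times[0,\infty)$ the variable $\eta_Z(C)$ is Poisson distributed with parameter $\mathbb E\,\eta_Z(C)\in[0,\infty]$ (almost surely infinite if the parameter is $\infty$); the values of $\eta_Z$ on finitely many pairwise disjoint measurable sets are independent; $\mathbb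 E\,\eta_Z(B\times I)=\hat\nu(B)\,\lambda(I)$ with $\lambda$ the Lebesgue measure; and, for every $U\in\mathcal B(Z)$ and $0\le s<t$, the variable $\eta_Z(U\times(0,t])$ is $\mathcal F_t$-measurable and $\eta_Z(U\times(s,t])$ is independent of $\mathcal F_s$. This holds for the completed natural filtration of $\eta$, i.e. $\mathcal F_t$ generated by the null sets and the measure-valued variables $\Pi(s)(A\times B)=\eta(A\times[0,s)\times B)$, $s\le t$, and more generally for every complete filtration to which $\Pi$ is adapted and for which, whenever $s<t$, the values of $\eta$ on measurable sets of points with time coordinate in $(s,t]$ of the form $\{(\xi,r,\zeta):(\xi,\zeta)\in D,\ r\in(s,t]\}$ are independent of $\mathcal F_s$. -/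

import Mathlib

open MeasureTheory ProbabilityTheory Set
open scoped NNReal ENNReal SchwartzMap

noncomputable section

namespace PoissonBesov

/-- A bounded domain (nonempty, open, connected) of `ℝ^d` with smooth boundary: near each boundary
point the domain is the region where a smooth function with nonvanishing differential is negative. -/
structure IsSmoothBoundedDomain {d : ℕ} (O : Set (EuclideanSpace ℝ (Fin d))) : Prop where
  isOpen : IsOpen O
  isConnected : IsConnected O
  isBounded : Bornology.IsBounded O
  smooth_boundary : ∀ x ∈ frontier O, ∃ ρ : EuclideanSpace ℝ (Fin d) → ℝ,
    ContDiff ℝ ((⊤ : ℕ∞) : WithTop ℕ∞) ρ ∧ fderiv ℝ ρ x ≠ 0 ∧ ∃ U : Set (EuclideanSpace ℝ (Fin d)),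
      IsOpen U ∧ x ∈ U ∧ ∀ y ∈ U, y ∈ O ↔ ρ y < 0

/-! ### Lévy measures on the real line -/

/-- The symmetric part `(ν + ν⁻) / 2` of a measure on `ℝ`, with `ν⁻ A = ν (-A)`. -/
def symmPart (ν : Measure ℝ) : Measure ℝ := (2⁻¹ : ℝ≥0∞) • (ν + ν.map (fun x => -x))

/-- A symmetric Lévy measure: `σ`-finite, symmetric, without mass at `0`, and such that
`a ↦ exp (∫ (cos (a x) - 1) dν)` is the characteristic function of a (Radon) probability measure. -/
structure IsSymmLevyMeasure (ν : Measure ℝ) : Prop where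
  sigmaFinite : SigmaFinite ν
  symm : ν.map (fun x => -x) = ν
  zero : ν {0} = 0
  exists_charFun : ∃ μ : Measure ℝ, IsProbabilityMeasure μ ∧ ∀ a : ℝ,
    Integrable (fun x => Real.cos (a * x) - 1) ν ∧
      charFun μ a = ((Real.exp (∫ x, (Real.cos (a * x) - 1) ∂ν) : ℝ) : ℂ)

/-- A Lévy measure on `ℝ`: a `σ`-finite measure whose symmetric part is a symmetric Lévy measure. -/
structure IsLevyMeasure (ν : Measure ℝ) : Prop where
  sigmaFinite : SigmaFinite ν
  symmPart : IsSymmLevyMeasure (symmPart ν)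

/-! ### Besov spaces `B^s_{p,∞}` -/

section Besov

variable {d : ℕ}

/-- The generating cut-off of the dyadic resolution of unity. -/
structure IsCutoff (ψ : EuclideanSpace ℝ (Fin d) → ℝ) : Prop where
  smooth : ContDiff ℝ ((⊤ : ℕ∞) : WithTop ℕ∞) ψ
  nonneg : ∀ x, 0 ≤ ψ x
  le_one : ∀ x, ψ x ≤ 1
  eq_one : ∀ x, ‖x‖ ≤ 1 → ψ x = 1
  eq_zero : ∀ x, 3 / 2 ≤ ‖x‖ → ψ x = 0

/-- The dyadic resolution of unity: `φ_0 = ψ` and `φ_j x = ψ (2^{-j} x) - ψ (2^{-j+1} x)`, which is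
`φ_1 (2^{-j+1} x)` for `φ_1 x = ψ (x / 2) - ψ x`. -/
def dyadic (ψ : EuclideanSpace ℝ (Fin d) → ℝ) : ℕ → EuclideanSpace ℝ (Fin d) → ℝ
  | 0 => ψ
  | j + 1 => fun x => ψ (((2 : ℝ) ^ (j + 1))⁻¹ • x) - ψ (((2 : ℝ) ^ j)⁻¹ • x)

/-- The `L^p` norm of a tempered distribution: the norm of the `L^p` function that represents it,
and `∞` if there is none. -/
def lpNorm (p : ℝ≥0∞) (u : 𝓢'(EuclideanSpace ℝ (Fin d), ℂ)) : ℝ≥0∞ :=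
  ⨅ (g : EuclideanSpace ℝ (Fin d) → ℂ) (_ : MemLp g p volume)
    (_ : ∀ φ : 𝓢(EuclideanSpace ℝ (Fin d), ℂ), u φ = ∫ x, φ x * g x), eLpNorm g p volume

/-- The norm of `B^s_{p,∞}(ℝ^d)`, i.e. `sup_j 2^{sj} ‖F⁻¹ (φ_j F f)‖_{L^p}`. Here
`F f (ξ) = (2π)^{-d/2} ∫ exp (-i⟨x, ξ⟩) f x dx`; since the Fourier transform of the library has the
kernel `exp (-2πi⟨x, ξ⟩)`, the symbol `φ_j` is evaluated at `2π ξ`. -/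
def besovNorm (ψ : EuclideanSpace ℝ (Fin d) → ℝ) (s : ℝ) (p : ℝ≥0∞)
    (f : 𝓢'(EuclideanSpace ℝ (Fin d), ℂ)) : ℝ≥0∞ :=
  ⨆ j : ℕ, ENNReal.ofReal ((2 : ℝ) ^ (s * (j : ℝ))) *
    lpNorm p (TemperedDistribution.fourierMultiplierCLM ℂ
      (fun ξ => ((dyadic ψ j ((2 * Real.pi) • ξ) : ℝ) : ℂ)) f)

/-- The Besov space `B^s_{p,∞}(Ō)` on the closure of `O`: the elements of `B^s_{p,∞}(ℝ^d)` with
support in the closure of `O`. -/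
def BesovSpace (ψ : EuclideanSpace ℝ (Fin d) → ℝ) (s : ℝ) (p : ℝ≥0∞)
    (O : Set (EuclideanSpace ℝ (Fin d))) : Type :=
  {f : 𝓢'(EuclideanSpace ℝ (Fin d), ℂ) //
    besovNorm ψ s p f < ∞ ∧ Distribution.dsupport f ⊆ closure O}

variable {ψ : EuclideanSpace ℝ (Fin d) → ℝ} {s : ℝ} {p : ℝ≥0∞} {O : Set (EuclideanSpace ℝ (Fin d))}

/-- The Besov space carries the weak-* topology: convergence against test functions. -/
instance : TopologicalSpace (BesovSpace ψ s p O) := instTopologicalSpaceSubtype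

/-- The Borel `σ`-field of the weak-* topology. It contains all closed norm balls. -/
instance : MeasurableSpace (BesovSpace ψ s p O) := borel _

end Besov

/-! ### Poisson random measures -/

section Random

variable {Ω : Type*} [mΩ : MeasurableSpace Ω]

/-- `X` is a Poisson random variable with parameter `a ∈ [0, ∞]`; for `a = ∞` this means that
`X = ∞` almost surely. -/
def IsPoissonVar (P : Measure Ω) (X : Ω → ℝ≥0∞) (a : ℝ≥0∞) : Prop :=
  (a = ∞ → ∀ᵐ ω ∂P, X ω = ∞) ∧
    (a ≠ ∞ → P.map X = (poissonMeasure a.toNNReal).map (fun n : ℕ => (n : ℝ≥0∞)))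

/-- The values of the measure `m` on measurable sets lie in `{0, 1, 2, …} ∪ {∞}`. -/
def IsIntegerValued {α : Type*} [MeasurableSpace α] (m : Measure α) : Prop :=
  ∀ B, MeasurableSet B → ∃ n : ℕ∞, m B = (n : ℝ≥0∞)

/-- Lebesgue measure on the time axis `[0, ∞)`. -/
def timeMeasure : Measure ℝ≥0 := (volume : Measure ℝ).comap (fun t : ℝ≥0 => (t : ℝ))

/-- Lebesgue measure on `O ⊆ ℝ^d`. -/
def spaceMeasure {d : ℕ} (O : Set (EuclideanSpace ℝ (Fin d))) : Measure O :=
  (volume : Measure (EuclideanSpace ℝ (Fin d))).comap (fun ξ : O => (ξ : EuclideanSpace ℝ (Fin d)))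

/-- A Poisson random measure on `Z` over the filtered probability space `(Ω, 𝓕, P)`. -/
structure IsPoissonRandomMeasure {Z : Type*} [MeasurableSpace Z] (P : Measure Ω)
    (𝓕 : Filtration ℝ≥0 mΩ) (N : Ω → Measure (Z × ℝ≥0)) : Prop where
  measurable : Measurable N
  integerValued : ∀ ω, IsIntegerValued (N ω)
  poisson : ∀ B, MeasurableSet B → IsPoissonVar P (fun ω => N ω B) (∫⁻ ω, N ω B ∂P)
  indep : ∀ (n : ℕ) (B : Fin n → Set (Z × ℝ≥0)), (∀ i, MeasurableSet (B i)) →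
    Pairwise (fun i j => Disjoint (B i) (B j)) → iIndepFun (fun i ω => N ω (B i)) P
  adapted : ∀ U, MeasurableSet U → ∀ t, Measurable[𝓕 t] (fun ω => N ω (U ×ˢ Ioc 0 t))
  indep_past : ∀ U, MeasurableSet U → ∀ s t, s < t →
    Indep (MeasurableSpace.comap (fun ω => N ω (U ×ˢ Ioc s t)) inferInstance) (𝓕 s) P

/-- A time homogeneous Poisson random measure with intensity measure `ν`. -/
structure IsTimeHomogeneousPRM {Z : Type*} [MeasurableSpace Z] (P : Measure Ω)
    (𝓕 : Filtration ℝ≥0 mΩ) (ν : Measure Z) (N : Ω → Measure (Z × ℝ≥0)) : Prop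
    extends IsPoissonRandomMeasure P 𝓕 N where
  intensity : ∀ A I, MeasurableSet A → MeasurableSet I →
    ∫⁻ ω, N ω (A ×ˢ I) ∂P = ν A * timeMeasure I

/-- A Poissonian white noise on `(S, σ)` with jump size intensity `ν`. -/
structure IsPoissonianWhiteNoise {S : Type*} [MeasurableSpace S] (P : Measure Ω) (σ : Measure S)
    (ν : Measure ℝ) (η : Ω → Measure (S × ℝ)) : Prop where
  measurable : Measurable η
  integerValued : ∀ ω, IsIntegerValued (η ω)
  poisson : ∀ A B, MeasurableSet A → MeasurableSet B → σ A * ν B < ∞ →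
    IsPoissonVar P (fun ω => η ω (A ×ˢ B)) (σ A * ν B)
  indep : ∀ (n : ℕ) (A : Fin n → Set S) (B : Fin n → Set ℝ), (∀ i, MeasurableSet (A i)) →
    (∀ i, MeasurableSet (B i)) → Pairwise (fun i j => Disjoint (A i ×ˢ B i) (A j ×ˢ B j)) →
      iIndepFun (fun i ω => η ω (A i ×ˢ B i)) P

variable {X : Type*} [MeasurableSpace X]

/-- The measure valued process `Π(t) : A × B ↦ η (A × [0, t) × B)` of a space-time noise. -/
def noiseProcess (η : Ω → Measure ((X × ℝ≥0) × ℝ)) (t : ℝ≥0) (ω : Ω) : Measure (X × ℝ) :=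
  ((η ω).restrict {q | q.1.2 < t}).map (fun q => (q.1.1, q.2))

theorem measurable_noiseProcess {η : Ω → Measure ((X × ℝ≥0) × ℝ)} (hη : Measurable η) (t : ℝ≥0) :
    Measurable (noiseProcess η t) := by
  have hs : MeasurableSet {q : (X × ℝ≥0) × ℝ | q.1.2 < t} :=
    measurableSet_lt (measurable_snd.comp measurable_fst) measurable_const
  refine (Measure.measurable_map _ (by fun_prop)).comp
    (Measure.measurable_of_measurable_coe _ fun A hA => ?_)
  simp_rw [Measure.restrict_apply hA]
  exact (Measure.measurable_coe (hA.inter hs)).comp hη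

/-- The completed natural filtration of a space-time noise: `𝓕_t` is generated by `Π(s)`, `s ≤ t`,
and by the null sets. -/
def noiseFiltration (P : Measure Ω) [P.IsComplete] (η : Ω → Measure ((X × ℝ≥0) × ℝ))
    (hη : Measurable η) : Filtration ℝ≥0 mΩ where
  seq t := (⨆ s : ℝ≥0, ⨆ _ : s ≤ t, MeasurableSpace.comap (noiseProcess η s) inferInstance) ⊔
    MeasurableSpace.generateFrom {A | P A = 0}
  mono' t u htu := by
    refine sup_le (le_trans ?_ le_sup_left) le_sup_right
    exact iSup₂_le fun s hs => le_iSup₂_of_le s (hs.trans htu) le_rfl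
  le' t := by
    refine sup_le (iSup₂_le fun s _ => (measurable_noiseProcess hη s).comap_le) ?_
    exact MeasurableSpace.generateFrom_le fun A hA => Measure.IsComplete.out' A hA

/-- The space-time noise `η` is a noise over `(Ω, 𝓕, P)`: the process `Π` is `𝓕`-adapted and the
increments of `η` in time are independent of the past. -/
structure IsNoiseOver (P : Measure Ω) (𝓕 : Filtration ℝ≥0 mΩ)
    (η : Ω → Measure ((X × ℝ≥0) × ℝ)) : Prop where
  adapted : ∀ t, Measurable[𝓕 t] (noiseProcess η t)
  indep_past : ∀ D : Set (X × ℝ), MeasurableSet D → ∀ s t, s < t →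
    Indep (MeasurableSpace.comap
      (fun ω => η ω {q | (q.1.1, q.2) ∈ D ∧ q.1.2 ∈ Ioc s t}) inferInstance) (𝓕 s) P

/-- The image of a space-time noise under a map `J` that acts on position and jump size. -/
def pushNoise {Z : Type*} [MeasurableSpace Z] (J : X × ℝ → Z)
    (η : Ω → Measure ((X × ℝ≥0) × ℝ)) (ω : Ω) : Measure (Z × ℝ≥0) :=
  (η ω).map (fun q => (J (q.1.1, q.2), q.1.2))

end Random

end PoissonBesov

end

/-! Two independent facts are combined. On the analytic side, the Littlewood-Paley blocks of `δ_ξ`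
are translates of kernels which, for `j ≥ 1`, are `L^1`-normalised dilates of a single Schwartz
function. The norm of block `j` in `L^p` therefore grows like `2^{j(d - d/p)}`, which the weight of
`B^{d/p-d}_{p,∞}` cancels exactly (`besovNorm_smul_delta_lt_top`). Tested against `φ`, the element
`ζδ_ξ` gives `ζφ(ξ)`, so the jump map is weak-* continuous and hence Borel.

On the probabilistic side, the noise is prescribed only on rectangles, while preimages under the
jump map are arbitrary measurable sets. The bridge is the identity `E exp(i∫f dη) = exp(∫(e^{if} -
1) dM)` with `M = E η = σ ⊗ ν`. Both sides are continuous in `f` for `L^1(M)`, by Campbell's formula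
and the Lipschitz bound for `e^{ix}`. For simple functions over the algebra of rectangles it follows
by passing to the atoms of a common partition, and density extends it to all simple functions with
sets of finite intensity. No disjointness is asked of these sets, since approximants of disjoint
sets may overlap. On disjoint sets the identity says precisely that the values are independent
Poisson variables; sets of infinite intensity are reached by exhaustion.

The Poisson property and independence then pull back along the jump map. The filtration claims use
independence over disjoint time slabs and the absence of atoms in time. -/

noncomputable section

namespace PoissonBesov

/-! ### Point masses in the Besov space -/

section Delta

open FourierTransform

variable {d : ℕ}

/-- The Fourier multiplier with a Schwartz symbol maps `δ_ξ` to a translate of the kernel. -/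
theorem fourierMultiplierCLM_delta (G : 𝓢(EuclideanSpace ℝ (Fin d), ℂ))
    (ξ : EuclideanSpace ℝ (Fin d)) (φ : 𝓢(EuclideanSpace ℝ (Fin d), ℂ)) :
    TemperedDistribution.fourierMultiplierCLM ℂ (G : EuclideanSpace ℝ (Fin d) → ℂ)
      (TemperedDistribution.delta ξ) φ = ∫ x, φ x * (𝓕⁻ G) (x - ξ) := by
  -- Writing the translated kernel as an inverse transform lets Fourier duality move `𝓕⁻` onto `φ`;
  -- what remains is that translation by `ξ` becomes multiplication by a character.
  have key : ∀ x, (𝓕⁻ G) (x - ξ) = (𝓕⁻ (𝓕 ((𝓕⁻ G).compSubConstCLM ℂ ξ))) x := by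
    intro x
    simp
  rw [TemperedDistribution.fourierMultiplierCLM_apply_apply, TemperedDistribution.delta_apply]
  simp_rw [key]
  have h := SchwartzMap.integral_fourierInv_mul_eq φ (𝓕 ((𝓕⁻ G).compSubConstCLM ℂ ξ))
  rw [← h, SchwartzMap.fourier_coe, Real.fourier_eq]
  refine integral_congr_ae (Filter.Eventually.of_forall fun v => ?_)
  have e1 : (𝓕 ((𝓕⁻ G).compSubConstCLM ℂ ξ)) v = Real.fourierChar (-(inner ℝ v ξ)) • G v := by
    rw [SchwartzMap.fourier_coe]
    have := congrFun (VectorFourier.fourierIntegral_comp_add_right Real.fourierChar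
      (volume : Measure (EuclideanSpace ℝ (Fin d))) (innerₗ (EuclideanSpace ℝ (Fin d)))
      (𝓕⁻ G : 𝓢(EuclideanSpace ℝ (Fin d), ℂ)) (-ξ)) v
    have h2 : 𝓕 (((𝓕⁻ G : 𝓢(EuclideanSpace ℝ (Fin d), ℂ))) : EuclideanSpace ℝ (Fin d) → ℂ) v
        = G v := by
      rw [← SchwartzMap.fourier_coe]; simp
    rw [← h2]
    convert this using 2
    · simp only [Function.comp_def, ← sub_eq_add_neg]
      rfl
    · simp [real_inner_comm]
    · rfl
  simp only [e1]
  rw [SchwartzMap.smulLeftCLM_apply_apply G.hasTemperateGrowth]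
  simp only [Circle.smul_def, smul_eq_mul]
  ring

/-- Scaling of the `L^p` norm under dilations. -/
theorem eLpNorm_comp_smul (h : 𝓢(EuclideanSpace ℝ (Fin d), ℂ)) {p : ℝ} (hp : 0 < p) {r : ℝ}
    (hr : 0 < r) :
    eLpNorm (fun x => h (r • x)) (ENNReal.ofReal p) volume =
      ENNReal.ofReal (r ^ (-(d : ℝ) / p)) * eLpNorm h (ENNReal.ofReal p) volume := by
  have hm : MeasurableEmbedding (fun x : EuclideanSpace ℝ (Fin d) => r • x) :=
    (Homeomorph.smulOfNeZero r hr.ne').measurableEmbedding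
  have := hm.eLpNorm_map_measure (g := h) (p := ENNReal.ofReal p) (μ := volume)
  rw [Function.comp_def] at this
  rw [← this, Measure.map_addHaar_smul _ hr.ne',
    eLpNorm_smul_measure_of_ne_top ENNReal.ofReal_ne_top, smul_eq_mul,
    ENNReal.toReal_div, ENNReal.toReal_ofReal hp.le, ENNReal.toReal_one,
    ENNReal.ofReal_rpow_of_pos (by positivity)]
  congr 2
  rw [abs_of_pos (by positivity), finrank_euclideanSpace_fin, ← Real.rpow_natCast,
    ← Real.rpow_neg hr.le, ← Real.rpow_mul hr.le]
  congr 1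
  simp; ring

/-- The inverse Fourier transform of a dilated function. -/
theorem fourierInv_comp_smul (g : EuclideanSpace ℝ (Fin d) → ℂ) {r : ℝ} (hr : 0 < r)
    (y : EuclideanSpace ℝ (Fin d)) :
    𝓕⁻ (fun x => g (r⁻¹ • x)) y = ((r ^ d : ℝ) : ℂ) * 𝓕⁻ g (r • y) := by
  rw [Real.fourierInv_eq, Real.fourierInv_eq]
  have := Measure.integral_comp_smul (volume : Measure (EuclideanSpace ℝ (Fin d)))
    (fun v => Real.fourierChar (inner ℝ v (r • y)) • g v) r⁻¹
  have e : ∀ v, Real.fourierChar (inner ℝ (r⁻¹ • v) (r • y)) • g (r⁻¹ • v) =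
      Real.fourierChar (inner ℝ v y) • g (r⁻¹ • v) := by
    intro v
    congr 2
    rw [real_inner_smul_left, real_inner_smul_right]
    field_simp
  simp only [e] at this
  rw [this, finrank_euclideanSpace_fin, abs_of_pos (by positivity)]
  simp

variable {ψ : EuclideanSpace ℝ (Fin d) → ℝ}

theorem IsCutoff.hasCompactSupport_comp_smul (hψ : IsCutoff ψ) {r : ℝ} (hr : 0 < r) :
    HasCompactSupport fun x => ψ (r • x) := by
  refine HasCompactSupport.intro (isCompact_closedBall 0 (3 / 2 / r)) fun x hx => ?_
  refine hψ.eq_zero _ ?_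
  simp only [Metric.mem_closedBall, dist_zero_right, not_le] at hx
  rw [norm_smul, Real.norm_of_nonneg hr.le]
  rw [div_lt_iff₀ hr] at hx
  linarith

theorem IsCutoff.contDiff_dyadic (hψ : IsCutoff ψ) (j : ℕ) :
    ContDiff ℝ ((⊤ : ℕ∞) : WithTop ℕ∞) (dyadic ψ j) := by
  have := hψ.smooth
  cases j with
  | zero => exact this
  | succ j => exact (this.comp (contDiff_const_smul _)).sub (this.comp (contDiff_const_smul _))

theorem IsCutoff.hasCompactSupport_dyadic (hψ : IsCutoff ψ) (j : ℕ) :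
    HasCompactSupport (dyadic ψ j) := by
  cases j with
  | zero => simpa [dyadic] using hψ.hasCompactSupport_comp_smul one_pos
  | succ j =>
    exact (hψ.hasCompactSupport_comp_smul (by positivity)).sub
      (hψ.hasCompactSupport_comp_smul (by positivity))

theorem dyadic_succ (j : ℕ) (x : EuclideanSpace ℝ (Fin d)) :
    dyadic ψ (j + 1) x = dyadic ψ 1 (((2 : ℝ) ^ j)⁻¹ • x) := by
  simp only [dyadic, smul_smul, pow_succ, zero_add, pow_zero]
  congr 3 <;> simp [mul_comm]

/-- The symbol of the `j`-th Littlewood-Paley projection as a Schwartz function. -/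
def dyadicSymbol (hψ : IsCutoff ψ) (j : ℕ) : 𝓢(EuclideanSpace ℝ (Fin d), ℂ) :=
  HasCompactSupport.toSchwartzMap (f := fun ξ => ((dyadic ψ j ((2 * Real.pi) • ξ) : ℝ) : ℂ))
    (((hψ.hasCompactSupport_dyadic j).comp_homeomorph
      (Homeomorph.smulOfNeZero (2 * Real.pi) (by positivity))).comp_left Complex.ofReal_zero)
    (Complex.ofRealCLM.contDiff.comp ((hψ.contDiff_dyadic j).comp (contDiff_const_smul _)))

theorem coe_dyadicSymbol (hψ : IsCutoff ψ) (j : ℕ) :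
    (dyadicSymbol hψ j : EuclideanSpace ℝ (Fin d) → ℂ) =
      fun ξ => ((dyadic ψ j ((2 * Real.pi) • ξ) : ℝ) : ℂ) := rfl

/-- The convolution kernel of the `j`-th Littlewood-Paley projection. -/
def dyadicKernel (hψ : IsCutoff ψ) (j : ℕ) : 𝓢(EuclideanSpace ℝ (Fin d), ℂ) :=
  𝓕⁻ (dyadicSymbol hψ j)

theorem dyadicKernel_succ (hψ : IsCutoff ψ) (j : ℕ) (y : EuclideanSpace ℝ (Fin d)) :
    (dyadicKernel hψ (j + 1)) y =
      ((((2 : ℝ) ^ j) ^ d : ℝ) : ℂ) * (dyadicKernel hψ 1) ((2 : ℝ) ^ j • y) := by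
  rw [dyadicKernel, dyadicKernel, SchwartzMap.fourierInv_coe, SchwartzMap.fourierInv_coe,
    ← fourierInv_comp_smul _ (by positivity)]
  refine congrFun (congrArg _ (funext fun x => ?_)) y
  simp only [coe_dyadicSymbol]
  rw [dyadic_succ, smul_comm]

/-- The prefactor `2^{jd}` of the dilated kernel contributes `d` to the exponent and the change of
variables in the `L^p` norm contributes `-d/p`. -/
theorem eLpNorm_dyadicKernel_succ (hψ : IsCutoff ψ) (j : ℕ) {p : ℝ} (hp : 0 < p) :
    eLpNorm (dyadicKernel hψ (j + 1)) (ENNReal.ofReal p) volume =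
      ENNReal.ofReal ((2 : ℝ) ^ ((d - d / p) * j)) *
        eLpNorm (dyadicKernel hψ 1) (ENNReal.ofReal p) volume := by
  have : (dyadicKernel hψ (j + 1) :
      EuclideanSpace ℝ (Fin d) → ℂ) = ((((2 : ℝ) ^ j) ^ d : ℝ) : ℂ) •
        fun y => (dyadicKernel hψ 1) ((2 : ℝ) ^ j • y) := by
    ext y
    exact dyadicKernel_succ hψ j y
  rw [this, eLpNorm_const_smul, eLpNorm_comp_smul _ hp (by positivity), ← mul_assoc,
    ← ofReal_norm, Complex.norm_real, Real.norm_of_nonneg (by positivity),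
    ← ENNReal.ofReal_mul (by positivity)]
  congr 2
  rw [← Real.rpow_natCast, ← Real.rpow_natCast, ← Real.rpow_mul (by positivity),
    ← Real.rpow_mul (by positivity), ← Real.rpow_add (by positivity)]
  congr 1
  ring

/-- The translated kernel represents the block of `δ_ξ`, so it is a competitor in the infimum
defining `lpNorm`; translation invariance removes `ξ`. -/
theorem lpNorm_smul_delta_le (hψ : IsCutoff ψ) (j : ℕ) (p : ℝ≥0∞) (c : ℂ)
    (ξ : EuclideanSpace ℝ (Fin d)) :
    lpNorm p (TemperedDistribution.fourierMultiplierCLM ℂ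
      (fun ξ => ((dyadic ψ j ((2 * Real.pi) • ξ) : ℝ) : ℂ)) (c • TemperedDistribution.delta ξ)) ≤
      ‖c‖ₑ * eLpNorm (dyadicKernel hψ j) p volume := by
  have hmp : MeasurePreserving (fun x : EuclideanSpace ℝ (Fin d) => x - ξ) :=
    measurePreserving_sub_right volume ξ
  have hmem : MemLp (fun x => c • (dyadicKernel hψ j) (x - ξ)) p volume :=
    (((dyadicKernel hψ j).memLp p volume).comp_measurePreserving hmp).const_smul c
  refine ((iInf_le _ (fun x => c • (dyadicKernel hψ j) (x - ξ))).trans <|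
    (iInf_le _ hmem).trans (iInf_le _ fun φ => ?_)).trans_eq ?_
  · have h := fourierMultiplierCLM_delta (dyadicSymbol hψ j) ξ φ
    rw [coe_dyadicSymbol] at h
    rw [map_smul]
    refine (congrArg (c • ·) h).trans ?_
    rw [smul_eq_mul, ← integral_const_mul]
    congr 1
    ext x
    simp only [smul_eq_mul, dyadicKernel]
    ring
  · have := eLpNorm_const_smul c (fun x => (dyadicKernel hψ j) (x - ξ)) p volume
    rw [Pi.smul_def] at this
    rw [this]
    congr 1
    exact eLpNorm_comp_measurePreserving
      (dyadicKernel hψ j).continuous.aestronglyMeasurable hmp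

/-- Multiples of point masses belong to `B^{d/p-d}_{p,∞}`. -/
theorem besovNorm_smul_delta_lt_top (hψ : IsCutoff ψ) {p : ℝ} (hp : 0 < p) (c : ℂ)
    (ξ : EuclideanSpace ℝ (Fin d)) :
    besovNorm ψ ((d : ℝ) / p - d) (ENNReal.ofReal p) (c • TemperedDistribution.delta ξ) < ∞ := by
  set N : ℕ → ℝ≥0∞ := fun j => eLpNorm (dyadicKernel hψ j) (ENNReal.ofReal p) volume
  have hN : ∀ j, N j ≠ ∞ := fun j => ((dyadicKernel hψ j).memLp _ volume).2.ne
  -- Two terms suffice: block `0`, and one common value for all blocks `j ≥ 1`.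
  have hfin : ‖c‖ₑ * (N 0 + ENNReal.ofReal ((2 : ℝ) ^ ((d : ℝ) / p - d)) * N 1) < ∞ :=
    ENNReal.mul_lt_top enorm_lt_top (ENNReal.add_lt_top.2
      ⟨(hN 0).lt_top, ENNReal.mul_lt_top ENNReal.ofReal_lt_top (hN 1).lt_top⟩)
  refine lt_of_le_of_lt (iSup_le fun j => ?_) hfin
  refine (mul_le_mul_right (lpNorm_smul_delta_le hψ j (ENNReal.ofReal p) c ξ) _).trans ?_
  rw [mul_left_comm]
  refine mul_le_mul_right ?_ _
  cases j with
  | zero => simp [N]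
  | succ j =>
    refine le_add_left (le_of_eq ?_)
    -- With `s = d/p - d` the exponents add up to `s(j+1) - sj = s`, free of `j`.
    rw [eLpNorm_dyadicKernel_succ hψ j hp, ← mul_assoc,
      ← ENNReal.ofReal_mul (by positivity), ← Real.rpow_add (by positivity)]
    congr 3
    push_cast
    ring

theorem dsupport_smul_delta_subset (c : ℂ) (ξ : EuclideanSpace ℝ (Fin d)) :
    Distribution.dsupport (c • TemperedDistribution.delta ξ :
      𝓢'(EuclideanSpace ℝ (Fin d), ℂ)) ⊆ {ξ} := by
  rw [← Distribution.TemperedDistribution.dsupport_delta ξ]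
  refine Distribution.dsupport_subset_dsupport fun s _ hs u hu => ?_
  change c • TemperedDistribution.delta ξ u = 0
  rw [hs u hu, smul_zero]

variable {O : Set (EuclideanSpace ℝ (Fin d))} {p : ℝ}

/-- The map `(ξ, ζ) ↦ ζ δ_ξ` into the Besov space. -/
def pointMass (O : Set (EuclideanSpace ℝ (Fin d))) (hψ : IsCutoff ψ) (hp : 0 < p) (q : O × ℝ) :
    BesovSpace ψ ((d : ℝ) / p - d) (ENNReal.ofReal p) O :=
  ⟨(q.2 : ℂ) • TemperedDistribution.delta (q.1 : EuclideanSpace ℝ (Fin d)),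
    besovNorm_smul_delta_lt_top hψ hp _ _,
    (dsupport_smul_delta_subset _ _).trans (singleton_subset_iff.2 (subset_closure q.1.2))⟩

/-- Weak-* continuity only has to be checked on each test function `φ`, where the map is `(ξ, ζ) ↦
ζφ(ξ)`. -/
theorem continuous_pointMass (hψ : IsCutoff ψ) (hp : 0 < p) :
    Continuous (pointMass O hψ hp) := by
  refine Continuous.subtype_mk (PointwiseConvergenceCLM.continuous_of_continuous_eval fun φ => ?_) _
  change Continuous fun q : O × ℝ => (q.2 : ℂ) • φ (q.1 : EuclideanSpace ℝ (Fin d))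
  have := φ.continuous
  fun_prop

theorem measurable_pointMass (hψ : IsCutoff ψ) (hp : 0 < p) : Measurable (pointMass O hψ hp) := by
  have : BorelSpace (BesovSpace ψ ((d : ℝ) / p - d) (ENNReal.ofReal p) O) := ⟨rfl⟩
  exact (continuous_pointMass hψ hp).measurable

end Delta

/-! ### Poisson variables and their characteristic functions -/

section PoissonLaw

theorem lintegral_natCast_poissonMeasure (r : ℝ≥0) :
    ∫⁻ n : ℕ, (n : ℝ≥0∞) ∂(poissonMeasure r) = r := by
  have hs : HasSum (fun n : ℕ => Real.exp (-r) * r ^ n / n.factorial * n) (r : ℝ) := by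
    -- The term `n = 0` vanishes, and after the shift `n + 1` cancels against the factorial, leaving
    -- `r` times the total mass.
    rw [← hasSum_nat_add_iff' 1]
    have := (hasSum_one_poissonMeasure r).mul_left (r : ℝ)
    simp only [Finset.range_one, Finset.sum_singleton, Nat.cast_zero, mul_zero, sub_zero]
    rw [mul_one] at this
    refine this.congr_fun fun n => ?_
    rw [Nat.factorial_succ]
    push_cast
    rw [pow_succ]
    field_simp
  rw [lintegral_countable', ← ENNReal.ofReal_coe_nnreal, ← hs.tsum_eq,
    ENNReal.ofReal_tsum_of_nonneg (fun n => by positivity) hs.summable]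
  congr 1 with n
  rw [poissonMeasure_singleton, ENNReal.ofReal_mul (by positivity), ENNReal.ofReal_natCast,
    mul_comm]

variable {Ω : Type*} [mΩ : MeasurableSpace Ω] {P : Measure Ω} {X : Ω → ℝ≥0∞} {a : ℝ≥0∞}

theorem IsPoissonVar.lintegral_eq (hX : Measurable X) (h : IsPoissonVar P X a) (ha : a ≠ ∞) :
    ∫⁻ ω, X ω ∂P = a := by
  have e : ∫⁻ ω, X ω ∂P = ∫⁻ x, x ∂(P.map X) := (lintegral_map measurable_id hX).symm
  rw [e, h.2 ha]
  refine (lintegral_map measurable_id .of_discrete).trans ?_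
  simp [lintegral_natCast_poissonMeasure, ha]

theorem IsPoissonVar.map_toReal (hX : Measurable X) (h : IsPoissonVar P X a) (ha : a ≠ ∞) :
    P.map (fun ω => (X ω).toReal) = (poissonMeasure a.toNNReal).map (Nat.cast : ℕ → ℝ) := by
  have : P.map (fun ω => (X ω).toReal) = (P.map X).map ENNReal.toReal := by
    rw [Measure.map_map ENNReal.measurable_toReal hX]; rfl
  rw [this, h.2 ha, Measure.map_map ENNReal.measurable_toReal .of_discrete]
  congr 1

/-- Almost sure finiteness is needed because `toReal` sends `∞` to `0`. -/
theorem IsPoissonVar.of_map_toReal (hX : Measurable X) (ha : a ≠ ∞) (hfin : ∀ᵐ ω ∂P, X ω ≠ ∞)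
    (h : P.map (fun ω => (X ω).toReal) = (poissonMeasure a.toNNReal).map (Nat.cast : ℕ → ℝ)) :
    IsPoissonVar P X a := by
  refine ⟨fun h => absurd h ha, fun _ => ?_⟩
  have e : X =ᵐ[P] fun ω => ENNReal.ofReal (X ω).toReal := by
    filter_upwards [hfin] with ω hω using (ENNReal.ofReal_toReal hω).symm
  have : P.map (fun ω => ENNReal.ofReal (X ω).toReal) =
      (P.map (fun ω => (X ω).toReal)).map ENNReal.ofReal := by
    rw [Measure.map_map ENNReal.measurable_ofReal hX.ennreal_toReal]; rfl
  rw [Measure.map_congr e, this, h, Measure.map_map ENNReal.measurable_ofReal .of_discrete]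
  congr 1
  ext n
  simp

variable [IsProbabilityMeasure P] {ι : Type*} [Fintype ι]

/-- Independent Poisson variables are characterized by their joint characteristic function. -/
theorem iIndepFun_and_map_eq_poisson_iff {N : ι → Ω → ℝ} (hN : ∀ i, Measurable (N i))
    (r : ι → ℝ≥0) :
    (iIndepFun N P ∧ ∀ i, P.map (N i) = (poissonMeasure (r i)).map (Nat.cast : ℕ → ℝ)) ↔
      ∀ t : ι → ℝ, ∫ ω, Complex.exp (Complex.I * (∑ i, t i * N i ω : ℝ)) ∂P =
        Complex.exp (∑ i, (r i : ℂ) * (Complex.exp (Complex.I * t i) - 1)) := by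
  have hjoint : ∀ t : ι → ℝ, charFun (P.map fun ω => WithLp.toLp 2 fun i => N i ω)
      (WithLp.toLp 2 t) = ∫ ω, Complex.exp (Complex.I * (∑ i, t i * N i ω : ℝ)) ∂P := by
    intro t
    rw [charFun_apply, integral_map (by fun_prop) (by fun_prop)]
    congr 1 with ω
    rw [mul_comm, PiLp.inner_apply]
    simp [mul_comm]
  constructor
  · rintro ⟨hi, hp⟩ t
    rw [← hjoint, (iIndepFun_iff_charFun_pi fun i => (hN i).aemeasurable).1 hi, Complex.exp_sum]
    refine Finset.prod_congr rfl fun i _ => ?_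
    rw [hp, charFun_map_cast_poissonMeasure, mul_comm Complex.I]
  · intro h
    have hp : ∀ i, P.map (N i) = (poissonMeasure (r i)).map (Nat.cast : ℕ → ℝ) := by
      classical
      intro i
      have : IsProbabilityMeasure (P.map (N i)) :=
        Measure.isProbabilityMeasure_map (hN i).aemeasurable
      refine Measure.ext_of_charFun (funext fun s => ?_)
      rw [charFun_map_cast_poissonMeasure, charFun_apply_real,
        integral_map (hN i).aemeasurable (by fun_prop)]
      -- Testing with a vector supported at `i` isolates the marginal law.
      have hs := h (Pi.single i s)
      have e1 : ∀ ω, ∑ j, (Pi.single i s : ι → ℝ) j * N j ω = s * N i ω := fun ω => by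
        rw [Finset.sum_eq_single i] <;> simp +contextual
      have e2 : ∑ j, (r j : ℂ) * (Complex.exp (Complex.I * (Pi.single i s : ι → ℝ) j) - 1) =
          (r i : ℂ) * (Complex.exp (s * Complex.I) - 1) := by
        rw [Finset.sum_eq_single i] <;> simp +contextual [mul_comm]
      simp only [e1, e2] at hs
      rw [← hs]
      congr 1 with ω
      push_cast
      ring_nf
    refine ⟨(iIndepFun_iff_charFun_pi fun i => (hN i).aemeasurable).2 fun t => ?_, hp⟩
    have : t = WithLp.toLp 2 (fun i => t i) := rfl
    rw [this, hjoint, h, Complex.exp_sum]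
    refine Finset.prod_congr rfl fun i _ => ?_
    rw [hp, charFun_map_cast_poissonMeasure, mul_comm Complex.I]

end PoissonLaw

/-! ### The Poisson characteristic functional and its `L^1` continuity -/

section RandomMeasure

open Filter Topology

variable {Ω : Type*} [mΩ : MeasurableSpace Ω] {P : Measure Ω}
  {X : Type*} [MeasurableSpace X] {κ : Kernel Ω X} {M : Measure X}

/-- The characteristic functional of the random measure `κ` at `f` is that of a Poisson random
measure with intensity `M`. -/
def HasPoissonCharFun (P : Measure Ω) (κ : Kernel Ω X) (M : Measure X) (f : X → ℝ) : Prop :=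
  ∫ ω, Complex.exp (Complex.I * (∫ x, f x ∂κ ω : ℝ)) ∂P =
    Complex.exp (∫ x, (Complex.exp (Complex.I * f x) - 1) ∂M)

theorem norm_exp_I_mul_sub_le (a b : ℝ) :
    ‖Complex.exp (Complex.I * a) - Complex.exp (Complex.I * b)‖ ≤ |a - b| := by
  have : Complex.exp (Complex.I * a) - Complex.exp (Complex.I * b) =
      Complex.exp (Complex.I * b) * (Complex.exp (Complex.I * (a - b : ℝ)) - 1) := by
    rw [mul_sub, ← Complex.exp_add]
    push_cast
    ring_nf
  rw [this, norm_mul, Complex.norm_exp_I_mul_ofReal, one_mul]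
  exact Real.norm_exp_I_mul_ofReal_sub_one_le

theorem integrable_exp_I_mul_sub_one {f : X → ℝ} (hf : Integrable f M) :
    Integrable (fun x => Complex.exp (Complex.I * f x) - 1) M := by
  refine hf.mono (((Complex.continuous_exp.comp (continuous_const.mul
    Complex.continuous_ofReal)).comp_aestronglyMeasurable hf.1).sub
      aestronglyMeasurable_const) (Eventually.of_forall fun x => ?_)
  exact Real.norm_exp_I_mul_ofReal_sub_one_le

theorem norm_integral_exp_sub_le {f g : X → ℝ} (hf : Integrable f M) (hg : Integrable g M) :
    ‖∫ x, (Complex.exp (Complex.I * f x) - 1) ∂M - ∫ x, (Complex.exp (Complex.I * g x) - 1) ∂M‖ ≤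
      ∫ x, |f x - g x| ∂M := by
  rw [← integral_sub (integrable_exp_I_mul_sub_one hf) (integrable_exp_I_mul_sub_one hg)]
  refine norm_integral_le_of_norm_le (hf.sub hg).abs (Eventually.of_forall fun x => ?_)
  rw [sub_sub_sub_cancel_right]
  exact norm_exp_I_mul_sub_le _ _

theorem ae_integrable_of_comp_eq (hκ : P.bind κ = M) {f : X → ℝ} (hf : Integrable f M) :
    ∀ᵐ ω ∂P, Integrable f (κ ω) :=
  Measure.ae_integrable_of_integrable_comp (hκ.symm ▸ hf)

theorem integrable_integral_of_comp_eq (hκ : P.bind κ = M) {f : X → ℝ} (hf : Integrable f M) :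
    Integrable (fun ω => ∫ x, f x ∂κ ω) P := by
  rw [← hκ, Measure.comp_eq_comp_const_apply] at hf
  exact hf.integral_comp

/-- Campbell's formula: the hypothesis `P.bind κ = M` says that `M` is the mean measure of `κ`. -/
theorem integral_integral_of_comp_eq (hκ : P.bind κ = M) {f : X → ℝ} (hf : Integrable f M) :
    ∫ ω, ∫ x, f x ∂κ ω ∂P = ∫ x, f x ∂M := by
  rw [← hκ, Measure.comp_eq_comp_const_apply] at hf ⊢
  exact (Kernel.integral_comp hf).symm

theorem ae_lt_top_of_comp_eq (hκ : P.bind κ = M) {R : Set X} (hR : MeasurableSet R)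
    (hfin : M R ≠ ∞) : ∀ᵐ ω ∂P, κ ω R ≠ ∞ := by
  have hm : Measurable fun ω => κ ω R := Kernel.measurable_coe κ hR
  rw [← hκ, Measure.bind_apply hR κ.aemeasurable] at hfin
  filter_upwards [ae_lt_top hm hfin] with ω hω using hω.ne

/-- On pairwise disjoint sets of finite intensity the Poisson characteristic functional expresses
that the values of the random measure are independent Poisson variables. -/
theorem hasPoissonCharFun_sum_indicator_iff (hκ : P.bind κ = M) {ι : Type*} [Fintype ι]
    {R : ι → Set X} (hR : ∀ i, MeasurableSet (R i)) (hfin : ∀ i, M (R i) ≠ ∞)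
    (hdisj : Pairwise fun i j => Disjoint (R i) (R j)) (t : ι → ℝ) :
    (HasPoissonCharFun P κ M fun x => ∑ i, (R i).indicator (fun _ => t i) x) ↔
      ∫ ω, Complex.exp (Complex.I * (∑ i, t i * (κ ω (R i)).toReal : ℝ)) ∂P =
        Complex.exp (∑ i, ((M (R i)).toNNReal : ℂ) * (Complex.exp (Complex.I * t i) - 1)) := by
  have hint : ∀ i, Integrable ((R i).indicator fun _ => t i) M := fun i =>
    (integrable_indicator_iff (hR i)).2 (integrableOn_const (hfin i))
  have hl : ∫ ω, Complex.exp (Complex.I *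
      (∫ x, ∑ i, (R i).indicator (fun _ => t i) x ∂κ ω : ℝ)) ∂P =
      ∫ ω, Complex.exp (Complex.I * (∑ i, t i * (κ ω (R i)).toReal : ℝ)) ∂P := by
    refine integral_congr_ae ?_
    filter_upwards [ae_all_iff.2 fun i => ae_integrable_of_comp_eq hκ (hint i)] with ω hω
    rw [integral_finsetSum _ fun i _ => hω i]
    simp_rw [integral_indicator_const _ (hR _), smul_eq_mul, mul_comm (t _)]
    rfl
  have hr : ∫ x, (Complex.exp (Complex.I *
      (∑ i, (R i).indicator (fun _ => t i) x : ℝ)) - 1) ∂M =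
      ∑ i, ((M (R i)).toNNReal : ℂ) * (Complex.exp (Complex.I * t i) - 1) := by
    have e : ∀ x, Complex.exp (Complex.I * (∑ i, (R i).indicator (fun _ => t i) x : ℝ)) - 1 =
        ∑ i, (R i).indicator (fun _ => Complex.exp (Complex.I * t i) - 1) x := by
      intro x
      by_cases hx : ∃ i, x ∈ R i
      · obtain ⟨i, hi⟩ := hx
        have hne : ∀ j, j ≠ i → x ∉ R j := fun j hj hxj =>
          Set.disjoint_left.1 (hdisj hj) hxj hi
        rw [Finset.sum_eq_single i (fun j _ hj => indicator_of_notMem (hne j hj) _) (by simp),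
          Finset.sum_eq_single i (fun j _ hj => indicator_of_notMem (hne j hj) _) (by simp),
          indicator_of_mem hi, indicator_of_mem hi]
      · push Not at hx
        rw [Finset.sum_eq_zero fun i _ => indicator_of_notMem (hx i) _,
          Finset.sum_eq_zero fun i _ => indicator_of_notMem (hx i) _]
        simp
    simp_rw [e]
    rw [integral_finsetSum _ fun i _ =>
      (integrable_indicator_iff (hR i)).2 (integrableOn_const (hfin i))]
    refine Finset.sum_congr rfl fun i _ => ?_
    rw [integral_indicator_const _ (hR i), Complex.real_smul]
    rfl
  rw [HasPoissonCharFun, hl, hr]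

variable [IsProbabilityMeasure P]

theorem integrable_exp_I_mul {Y : Ω → ℝ} (hY : AEStronglyMeasurable Y P) :
    Integrable (fun ω => Complex.exp (Complex.I * Y ω)) P :=
  Integrable.of_bound ((Complex.continuous_exp.comp (continuous_const.mul
    Complex.continuous_ofReal)).comp_aestronglyMeasurable hY) 1
      (Eventually.of_forall fun _ => (Complex.norm_exp_I_mul_ofReal _).le)

/-- Since `x ↦ e^{ix}` is 1-Lipschitz, the difference is at most `E ∫ |f - g| dκ`, which Campbell's
formula evaluates. -/
theorem norm_charFun_integral_sub_le (hκ : P.bind κ = M) {f g : X → ℝ} (hf : Integrable f M)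
    (hg : Integrable g M) :
    ‖∫ ω, Complex.exp (Complex.I * (∫ x, f x ∂κ ω : ℝ)) ∂P -
      ∫ ω, Complex.exp (Complex.I * (∫ x, g x ∂κ ω : ℝ)) ∂P‖ ≤ ∫ x, |f x - g x| ∂M := by
  have hfg : Integrable (fun x => |f x - g x|) M := (hf.sub hg).abs
  rw [← integral_sub (integrable_exp_I_mul (integrable_integral_of_comp_eq hκ hf).1)
    (integrable_exp_I_mul (integrable_integral_of_comp_eq hκ hg).1),
    ← integral_integral_of_comp_eq hκ hfg]
  refine norm_integral_le_of_norm_le (integrable_integral_of_comp_eq hκ hfg) ?_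
  filter_upwards [ae_integrable_of_comp_eq hκ hf, ae_integrable_of_comp_eq hκ hg] with ω h1 h2
  refine (norm_exp_I_mul_sub_le _ _).trans ?_
  rw [← integral_sub h1 h2]
  exact abs_integral_le_integral_abs

theorem HasPoissonCharFun.of_tendsto (hκ : P.bind κ = M) {g : ℕ → X → ℝ} {f : X → ℝ}
    (hg : ∀ n, Integrable (g n) M) (hf : Integrable f M)
    (hlim : Tendsto (fun n => ∫ x, |g n x - f x| ∂M) atTop (𝓝 0))
    (h : ∀ n, HasPoissonCharFun P κ M (g n)) : HasPoissonCharFun P κ M f := by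
  have h1 : Tendsto (fun n => ∫ ω, Complex.exp (Complex.I * (∫ x, g n x ∂κ ω : ℝ)) ∂P) atTop
      (𝓝 (∫ ω, Complex.exp (Complex.I * (∫ x, f x ∂κ ω : ℝ)) ∂P)) :=
    tendsto_iff_norm_sub_tendsto_zero.2 (squeeze_zero (fun n => norm_nonneg _)
      (fun n => norm_charFun_integral_sub_le hκ (hg n) hf) hlim)
  have h2 : Tendsto (fun n => ∫ x, (Complex.exp (Complex.I * g n x) - 1) ∂M) atTop
      (𝓝 (∫ x, (Complex.exp (Complex.I * f x) - 1) ∂M)) :=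
    tendsto_iff_norm_sub_tendsto_zero.2 (squeeze_zero (fun n => norm_nonneg _)
      (fun n => norm_integral_exp_sub_le (hg n) hf) hlim)
  refine tendsto_nhds_unique h1 ?_
  simp_rw [fun n => show _ = _ from h n]
  exact (Complex.continuous_exp.tendsto _).comp h2

theorem integrable_sum_indicator {ι : Type*} [Fintype ι] {R : ι → Set X}
    (hR : ∀ i, MeasurableSet (R i)) (hfin : ∀ i, M (R i) ≠ ∞) (t : ι → ℝ) :
    Integrable (fun x => ∑ i, (R i).indicator (fun _ => t i) x) M :=
  integrable_finsetSum _ fun i _ =>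
    (integrable_indicator_iff (hR i)).2 (integrableOn_const (hfin i))

/-- Approximation of indicators by a measure-dense family of sets. -/
theorem hasPoissonCharFun_sum_indicator_of_measureDense (hκ : P.bind κ = M) {𝒜 : Set (Set X)}
    (h𝒜 : M.MeasureDense 𝒜) {ι : Type*} [Fintype ι] (t : ι → ℝ)
    (h : ∀ D : ι → Set X, (∀ i, D i ∈ 𝒜) → (∀ i, M (D i) ≠ ∞) →
      HasPoissonCharFun P κ M fun x => ∑ i, (D i).indicator (fun _ => t i) x)
    {C : ι → Set X} (hC : ∀ i, MeasurableSet (C i)) (hfin : ∀ i, M (C i) ≠ ∞) :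
    HasPoissonCharFun P κ M fun x => ∑ i, (C i).indicator (fun _ => t i) x := by
  have key : ∀ n : ℕ, ∀ i, ∃ D ∈ 𝒜, M D ≠ ∞ ∧
      M (symmDiff (C i) D) < ENNReal.ofReal (1 / ((n : ℝ) + 1)) := fun n i =>
    h𝒜.fin_meas_approx (hC i) (hfin i) _ (by positivity)
  choose D hD hDfin hDC using key
  have hDm : ∀ n i, MeasurableSet (D n i) := fun n i => h𝒜.measurable _ (hD n i)
  refine HasPoissonCharFun.of_tendsto hκ
    (fun n => integrable_sum_indicator (hDm n) (hDfin n) t) (integrable_sum_indicator hC hfin t) ?_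
    fun n => h (D n) (hD n) (hDfin n)
  have hbound : ∀ n, ∫ x, |∑ i, (D n i).indicator (fun _ => t i) x -
      ∑ i, (C i).indicator (fun _ => t i) x| ∂M ≤ (∑ i, |t i|) * (1 / ((n : ℝ) + 1)) := by
    intro n
    have hSm : ∀ i, MeasurableSet (symmDiff (C i) (D n i)) := fun i => (hC i).symmDiff (hDm n i)
    have hSfin : ∀ i, M (symmDiff (C i) (D n i)) ≠ ∞ := fun i =>
      (hDC n i).ne_top
    have hle : ∀ x, |∑ i, (D n i).indicator (fun _ => t i) x -
        ∑ i, (C i).indicator (fun _ => t i) x| ≤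
        ∑ i, (symmDiff (C i) (D n i)).indicator (fun _ => |t i|) x := by
      intro x
      rw [← Finset.sum_sub_distrib]
      refine (Finset.abs_sum_le_sum_abs _ _).trans (Finset.sum_le_sum fun i _ => ?_)
      by_cases h1 : x ∈ C i <;> by_cases h2 : x ∈ D n i <;>
        simp [h1, h2, Set.mem_symmDiff]
    -- The two simple functions differ only on the symmetric differences, each of measure below
    -- `1/(n+1)`.
    refine (integral_mono ((integrable_sum_indicator (hDm n) (hDfin n) t).sub
      (integrable_sum_indicator hC hfin t)).abs
      (integrable_sum_indicator hSm hSfin fun i => |t i|) hle).trans ?_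
    rw [integral_finsetSum _ fun i _ =>
      (integrable_indicator_iff (hSm i)).2 (integrableOn_const (hSfin i)), Finset.sum_mul]
    refine Finset.sum_le_sum fun i _ => ?_
    rw [integral_indicator_const _ (hSm i), smul_eq_mul, mul_comm]
    refine mul_le_mul_of_nonneg_left ?_ (abs_nonneg _)
    exact ENNReal.toReal_le_of_le_ofReal (by positivity) (hDC n i).le
  refine squeeze_zero (fun n => integral_nonneg fun x => abs_nonneg _) hbound ?_
  simpa using tendsto_one_div_add_atTop_nhds_zero_nat.const_mul (∑ i, |t i|)

theorem hasPoissonCharFun_of_iIndepFun (hκ : P.bind κ = M) {ι : Type*} [Fintype ι]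
    {R : ι → Set X} (hR : ∀ i, MeasurableSet (R i)) (hfin : ∀ i, M (R i) ≠ ∞)
    (hdisj : Pairwise fun i j => Disjoint (R i) (R j))
    (hi : iIndepFun (fun i ω => κ ω (R i)) P)
    (hp : ∀ i, IsPoissonVar P (fun ω => κ ω (R i)) (M (R i))) (t : ι → ℝ) :
    HasPoissonCharFun P κ M fun x => ∑ i, (R i).indicator (fun _ => t i) x := by
  rw [hasPoissonCharFun_sum_indicator_iff hκ hR hfin hdisj]
  have hm : ∀ i, Measurable fun ω => κ ω (R i) := fun i => Kernel.measurable_coe κ (hR i)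
  exact (iIndepFun_and_map_eq_poisson_iff (fun i => (hm i).ennreal_toReal)
    fun i => (M (R i)).toNNReal).1
    ⟨hi.comp (fun _ => ENNReal.toReal) fun _ => ENNReal.measurable_toReal,
      fun i => (hp i).map_toReal (hm i) (hfin i)⟩ t

theorem iIndepFun_and_isPoissonVar_of_hasPoissonCharFun (hκ : P.bind κ = M) {ι : Type*} [Fintype ι]
    {R : ι → Set X} (hR : ∀ i, MeasurableSet (R i)) (hfin : ∀ i, M (R i) ≠ ∞)
    (hdisj : Pairwise fun i j => Disjoint (R i) (R j))
    (h : ∀ t : ι → ℝ, HasPoissonCharFun P κ M fun x => ∑ i, (R i).indicator (fun _ => t i) x) :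
    iIndepFun (fun i ω => κ ω (R i)) P ∧
      ∀ i, IsPoissonVar P (fun ω => κ ω (R i)) (M (R i)) := by
  have hm : ∀ i, Measurable fun ω => κ ω (R i) := fun i => Kernel.measurable_coe κ (hR i)
  have hf := fun i => ae_lt_top_of_comp_eq hκ (hR i) (hfin i)
  obtain ⟨h1, h2⟩ := (iIndepFun_and_map_eq_poisson_iff (fun i => (hm i).ennreal_toReal)
    fun i => (M (R i)).toNNReal).2
    fun t => (hasPoissonCharFun_sum_indicator_iff hκ hR hfin hdisj t).1 (h t)
  refine ⟨(h1.comp (fun _ => ENNReal.ofReal) fun _ => ENNReal.measurable_ofReal).congr fun i => ?_,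
    fun i => .of_map_toReal (hm i) (hfin i) (hf i) (h2 i)⟩
  filter_upwards [hf i] with ω hω using ENNReal.ofReal_toReal hω

end RandomMeasure

/-! ### From the characteristic functional to all measurable sets -/

section Extension

open Filter Topology

variable {Ω : Type*} [mΩ : MeasurableSpace Ω] {P : Measure Ω}
  {X : Type*} [MeasurableSpace X] {κ : Kernel Ω X} {M : Measure X}

theorem IsPoissonVar.measure_le_natCast {Y : Ω → ℝ≥0∞} {a : ℝ≥0∞} (hY : Measurable Y)
    (h : IsPoissonVar P Y a) (ha : a ≠ ∞) (m : ℕ) :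
    P {ω | Y ω ≤ m} = poissonMeasure a.toNNReal (Finset.range (m + 1) : Set ℕ) := by
  have hs : MeasurableSet {x : ℝ≥0∞ | x ≤ m} := measurableSet_Iic
  have e : P {ω | Y ω ≤ m} = P.map Y {x | x ≤ m} := by rw [Measure.map_apply hY hs]; rfl
  rw [e, h.2 ha, Measure.map_apply .of_discrete hs]
  congr 1
  ext n
  simp

variable [IsProbabilityMeasure P]

/-- Each of the finitely many masses `e^{-r} r^j / j!` tends to `0` as `r → ∞`. -/
theorem tendsto_poissonMeasure_range {r : ℕ → ℝ≥0} (hr : Tendsto r atTop atTop) (m : ℕ) :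
    Tendsto (fun k => poissonMeasure (r k) (Finset.range m : Set ℕ)) atTop (𝓝 0) := by
  simp_rw [← sum_measure_singleton, poissonMeasure_singleton]
  rw [← Finset.sum_const_zero (s := Finset.range m)]
  refine tendsto_finsetSum _ fun j _ => ?_
  have h1 := ((Real.tendsto_pow_mul_exp_neg_atTop_nhds_zero j).div_const (j.factorial : ℝ)).comp
    (NNReal.tendsto_coe_atTop.2 hr)
  rw [zero_div] at h1
  have h2 := ENNReal.tendsto_ofReal h1
  rw [ENNReal.ofReal_zero] at h2
  refine h2.congr fun k => ?_
  simp [mul_comm]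

/-- The characteristic functional of `κ` at all finite combinations of indicators is that of a
Poisson random measure. -/
def HasPoissonCharFunctional (P : Measure Ω) (κ : Kernel Ω X) (M : Measure X) : Prop :=
  ∀ (n : ℕ) (C : Fin n → Set X), (∀ i, MeasurableSet (C i)) → (∀ i, M (C i) ≠ ∞) →
    ∀ t : Fin n → ℝ, HasPoissonCharFun P κ M fun x => ∑ i, (C i).indicator (fun _ => t i) x

theorem HasPoissonCharFunctional.isPoissonVar_of_ne_top (H : HasPoissonCharFunctional P κ M)
    (hκ : P.bind κ = M) {C : Set X} (hC : MeasurableSet C) (hfin : M C ≠ ∞) :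
    IsPoissonVar P (fun ω => κ ω C) (M C) :=
  (iIndepFun_and_isPoissonVar_of_hasPoissonCharFun (ι := Fin 1) (R := fun _ => C) hκ
    (fun _ => hC) (fun _ => hfin) (fun i j hij => absurd (Subsingleton.elim i j) hij)
    (H 1 _ (fun _ => hC) fun _ => hfin)).2 0

/-- Exhaust `C` by sets `D k` of finite intensity tending to `∞`. Then `P(κ C ≤ m) ≤ P(κ (D k) ≤ m)
→ 0` for every `m`. -/
theorem HasPoissonCharFunctional.ae_eq_top [SigmaFinite M] (H : HasPoissonCharFunctional P κ M)
    (hκ : P.bind κ = M) {C : Set X} (hC : MeasurableSet C) (htop : M C = ∞) :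
    ∀ᵐ ω ∂P, κ ω C = ∞ := by
  set D : ℕ → Set X := fun k => C ∩ spanningSets M k
  have hD : ∀ k, MeasurableSet (D k) := fun k => hC.inter (measurableSet_spanningSets M k)
  have hDfin : ∀ k, M (D k) ≠ ∞ := fun k =>
    ((measure_mono inter_subset_right).trans_lt (measure_spanningSets_lt_top M k)).ne
  have hmono : Monotone D := fun i j hij => inter_subset_inter_right _ (monotone_spanningSets M hij)
  have hU : ⋃ k, D k = C := by rw [← inter_iUnion, iUnion_spanningSets, inter_univ]
  have hlim : Tendsto (fun k => (M (D k)).toNNReal) atTop atTop := by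
    rw [← ENNReal.tendsto_coe_nhds_top]
    have := tendsto_measure_iUnion_atTop (μ := M) hmono
    rw [hU, htop] at this
    exact this.congr fun k => (ENNReal.coe_toNNReal (hDfin k)).symm
  have hzero : ∀ m : ℕ, P {ω | κ ω C ≤ m} = 0 := by
    intro m
    refine le_antisymm (ge_of_tendsto' (tendsto_poissonMeasure_range hlim (m + 1)) fun k => ?_)
      zero_le
    rw [← (H.isPoissonVar_of_ne_top hκ (hD k) (hDfin k)).measure_le_natCast
      (Kernel.measurable_coe κ (hD k)) (hDfin k)]
    exact measure_mono fun ω (hω : κ ω C ≤ m) => (measure_mono inter_subset_left).trans hω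
  rw [ae_iff]
  refine measure_mono_null (fun ω (hω : ¬ κ ω C = ∞) => ?_) (measure_iUnion_null hzero)
  obtain ⟨m, hm⟩ := ENNReal.exists_nat_gt hω
  exact mem_iUnion.2 ⟨m, hm.le⟩

theorem HasPoissonCharFunctional.isPoissonVar [SigmaFinite M] (H : HasPoissonCharFunctional P κ M)
    (hκ : P.bind κ = M) {C : Set X} (hC : MeasurableSet C) :
    IsPoissonVar P (fun ω => κ ω C) (M C) :=
  ⟨fun htop => H.ae_eq_top hκ hC htop, fun hfin => (H.isPoissonVar_of_ne_top hκ hC hfin).2 hfin⟩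

/-- Values on sets of infinite intensity are almost surely the constant `∞`. Replacing those sets by
`∅` reduces to finite intensity, and a deterministic map restores the constants afterwards. -/
theorem HasPoissonCharFunctional.iIndepFun [SigmaFinite M] (H : HasPoissonCharFunctional P κ M)
    (hκ : P.bind κ = M) {ι : Type*} [Finite ι] {C : ι → Set X} (hC : ∀ i, MeasurableSet (C i))
    (hdisj : Pairwise fun i j => Disjoint (C i) (C j)) :
    iIndepFun (fun i ω => κ ω (C i)) P := by
  classical
  let e := (Finite.equivFin ι).symm
  refine (iIndepFun_precomp_of_bijective (g := e) e.bijective).1 ?_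
  set D : Fin (Nat.card ι) → Set X := fun i => if M (C (e i)) = ∞ then ∅ else C (e i)
  have hDm : ∀ i, MeasurableSet (D i) := fun i => by
    by_cases h : M (C (e i)) = ∞ <;> simp [D, h, hC]
  have hDfin : ∀ i, M (D i) ≠ ∞ := fun i => by
    by_cases h : M (C (e i)) = ∞ <;> simp [D, h]
  have hsub : ∀ i, D i ⊆ C (e i) := fun i => by
    by_cases h : M (C (e i)) = ∞ <;> simp [D, h]
  have hind := (iIndepFun_and_isPoissonVar_of_hasPoissonCharFun hκ hDm hDfin
    (fun i j hij => (hdisj (e.injective.ne hij)).mono (hsub i) (hsub j))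
    (H _ D hDm hDfin)).1
  refine (hind.comp (fun i x => if M (C (e i)) = ∞ then ∞ else x) fun i => ?_).congr fun i => ?_
  · by_cases h : M (C (e i)) = ∞ <;> simp only [h, if_true, if_false] <;> fun_prop
  · by_cases h : M (C (e i)) = ∞
    · filter_upwards [H.ae_eq_top hκ (hC (e i)) h] with ω hω
      simp [h, hω]
    · exact Eventually.of_forall fun ω => by simp [D, h]

/-- The value on `H` is independent of the values on all sets that are disjoint from `H`. -/
theorem HasPoissonCharFunctional.indep_disjoint [SigmaFinite M]
    (hP : HasPoissonCharFunctional P κ M) (hκ : P.bind κ = M) {H : Set X} (hH : MeasurableSet H) :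
    Indep (⨆ G : {G : Set X // MeasurableSet G ∧ Disjoint G H},
        MeasurableSpace.comap (fun ω => κ ω G) inferInstance)
      (MeasurableSpace.comap (fun ω => κ ω H) inferInstance) P := by
  classical
  have hle : ∀ G : Set X, MeasurableSet G →
      MeasurableSpace.comap (fun ω => κ ω G) inferInstance ≤ mΩ := fun G hG =>
    (Kernel.measurable_coe κ hG).comap_le
  -- The supremum is a directed one over finite subfamilies, so a finite family `F` of sets
  -- suffices.
  rw [iSup_eq_iSup_finset]
  refine indep_iSup_of_monotone (fun F => ?_) (fun F => iSup₂_le fun G _ => hle _ G.2.1)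
    (hle H hH) fun F F' hF => biSup_mono fun G hG => Finset.mem_of_subset hF hG
  -- `none` labels `H`; `some α` labels the atom of points outside `H` lying in exactly the members
  -- of `F` that belong to `α`.
  let R : Option (Set F) → Set X := fun o => o.elim H fun α => {x | ∀ G : F, x ∈ G.1.1 ↔ G ∈ α} \ H
  have hR : ∀ o, MeasurableSet (R o) := by
    rintro (_ | α)
    · exact hH
    · refine MeasurableSet.diff ?_ hH
      rw [show {x | ∀ G : F, x ∈ G.1.1 ↔ G ∈ α} = ⋂ G : F, {x | x ∈ G.1.1 ↔ G ∈ α} by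
        ext; simp]
      refine MeasurableSet.iInter fun G => ?_
      by_cases h : G ∈ α
      · simpa [h] using G.1.2.1
      · simp only [h, iff_false]
        exact G.1.2.1.compl
  have hdisj : Pairwise fun o o' => Disjoint (R o) (R o') := by
    rintro (_ | α) (_ | β) hne
    · exact absurd rfl hne
    · exact disjoint_sdiff_right
    · exact disjoint_sdiff_left
    · refine Set.disjoint_left.2 fun x hx hx' => hne ?_
      congr 1
      ext G
      exact (hx.1 G).symm.trans (hx'.1 G)
  have hind := hP.iIndepFun hκ hR hdisj
  let T : ∀ S : Finset (Option (Set F)), Ω → S → ℝ≥0∞ := fun S ω (o : S) => κ ω (R o.1)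
  have hT : ∀ (S : Finset (Option (Set F))) (o : S), Measurable[MeasurableSpace.comap (T S) inferInstance]
      fun ω => κ ω (R o.1) := fun S o => (measurable_pi_apply o).comp (comap_measurable (T S))
  have hfin := hind.indepFun_finset ({none}ᶜ) {none} (by simp [disjoint_compl_left])
    fun o => Kernel.measurable_coe κ (hR o)
  refine indep_of_indep_of_le_left (indep_of_indep_of_le_right hfin ?_) ?_
  · refine Measurable.comap_le ?_
    exact hT {none} ⟨none, by simp⟩
  · refine iSup₂_le fun G hG => Measurable.comap_le ?_
    -- As `G` misses `H`, it is the disjoint union of the atoms whose label contains it.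
    have hsum : ∀ ω, κ ω G = ∑ o : (({none}ᶜ : Finset (Option (Set F)))),
        if ∃ α, o.1 = some α ∧ (⟨G, hG⟩ : F) ∈ α then κ ω (R o.1) else 0 := by
      intro ω
      rw [Finset.sum_coe_sort ({none}ᶜ : Finset (Option (Set F)))
        (fun o => if ∃ α, o = some α ∧ (⟨G, hG⟩ : F) ∈ α then κ ω (R o) else 0),
        ← Finset.sum_filter, ← measure_biUnion_finset (fun o _ o' _ h => hdisj h)
          fun o _ => hR o]
      congr 1
      ext x
      simp only [Finset.mem_filter, Finset.mem_compl, Finset.mem_singleton, mem_iUnion,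
        exists_prop]
      constructor
      · intro hx
        refine ⟨some {K | x ∈ K.1.1}, ⟨by simp, _, rfl, hx⟩, fun K => Iff.rfl, ?_⟩
        exact Set.disjoint_left.1 G.2.2 hx
      · rintro ⟨_, ⟨_, α, rfl, hα⟩, hx⟩
        exact (hx.1 ⟨G, hG⟩).2 hα
    simp_rw [hsum]
    refine Finset.measurable_sum _ fun o _ => ?_
    split_ifs
    · exact hT _ o
    · exact measurable_const

end Extension

/-! ### Null sets in σ-fields -/

section NullSets

variable {Ω : Type*} [mΩ : MeasurableSpace Ω] {P : Measure Ω}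

/-- Adjoining null sets preserves independence. -/
theorem indep_sup_generateFrom_null {m₁ m₂ : MeasurableSpace Ω} (h : Indep m₁ m₂ P) :
    Indep (m₁ ⊔ MeasurableSpace.generateFrom {A | P A = 0}) m₂ P := by
  -- Every set of the enlarged σ-field agrees almost everywhere with a set of `m₁`, and independence
  -- only sees sets up to null sets.
  have hle : m₁ ⊔ MeasurableSpace.generateFrom {A | P A = 0} ≤
      eventuallyMeasurableSpace m₁ (ae P) := by
    refine sup_le le_eventuallyMeasurableSpace 
      (MeasurableSpace.generateFrom_le fun A hA => ?_)
    exact ⟨∅, @MeasurableSet.empty Ω m₁, ae_eq_empty.2 hA⟩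
  rw [Indep_iff] at h ⊢
  rintro A B hA hB
  obtain ⟨A', hA', hAA'⟩ := hle A hA
  rw [measure_congr hAA', ← h A' B hA' hB]
  exact measure_congr (hAA'.inter Filter.EventuallyEq.rfl)

theorem measurable_of_ae_eq {m : MeasurableSpace Ω} (hm : ∀ A, P A = 0 → MeasurableSet[m] A)
    {β : Type*} [MeasurableSpace β] {f g : Ω → β} (hg : Measurable[m] g) (hfg : f =ᵐ[P] g) :
    Measurable[m] f := by
  intro B hB
  have hnull : P {ω | f ω ≠ g ω} = 0 := hfg
  have e : f ⁻¹' B = (g ⁻¹' B \ {ω | f ω ≠ g ω}) ∪ (f ⁻¹' B ∩ {ω | f ω ≠ g ω}) := by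
    ext ω
    by_cases h : f ω = g ω <;> simp [h]
  rw [e]
  exact ((hg hB).diff (hm _ hnull)).union (hm _ (measure_mono_null inter_subset_right hnull))

end NullSets

/-! ### The algebra of measurable rectangles -/

section RectAlgebra

variable {S T : Type*} [MeasurableSpace S] [MeasurableSpace T]

/-- The algebra generated by the measurable rectangles: the sets that are determined by finite
measurable partitions of the two factors. -/
def rectAlgebra (S T : Type*) [MeasurableSpace S] [MeasurableSpace T] : Set (Set (S × T)) :=
  {C | ∃ (I J : Type) (_ : Finite I) (_ : Finite J) (a : S → I) (b : T → J) (G : Set (I × J)),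
    (∀ i, MeasurableSet (a ⁻¹' {i})) ∧ (∀ j, MeasurableSet (b ⁻¹' {j})) ∧
      C = {q | (a q.1, b q.2) ∈ G}}

theorem measurableSet_preimage_prodMap {I J : Type*} [Finite I] [Finite J] {a : S → I} {b : T → J}
    (ha : ∀ i, MeasurableSet (a ⁻¹' {i})) (hb : ∀ j, MeasurableSet (b ⁻¹' {j}))
    (G : Set (I × J)) : MeasurableSet {q : S × T | (a q.1, b q.2) ∈ G} := by
  have : {q : S × T | (a q.1, b q.2) ∈ G} = ⋃ k ∈ G, (a ⁻¹' {k.1}) ×ˢ (b ⁻¹' {k.2}) := by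
    ext q
    simp only [mem_ofPred_eq, mem_iUnion, exists_prop, mem_prod, mem_preimage, mem_singleton_iff]
    exact ⟨fun h => ⟨_, h, rfl, rfl⟩, fun ⟨k, hk, h1, h2⟩ => by rwa [h1, h2]⟩
  rw [this]
  exact MeasurableSet.biUnion (Set.to_countable _) fun k _ => (ha _).prod (hb _)

theorem measurableSet_of_mem_rectAlgebra {C : Set (S × T)} (hC : C ∈ rectAlgebra S T) :
    MeasurableSet C := by
  obtain ⟨I, J, _, _, a, b, G, ha, hb, rfl⟩ := hC
  exact measurableSet_preimage_prodMap ha hb G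

theorem prod_mem_rectAlgebra {A : Set S} {B : Set T} (hA : MeasurableSet A)
    (hB : MeasurableSet B) : A ×ˢ B ∈ rectAlgebra S T := by
  -- `Prop` serves as a two-point label set, splitting each factor into a set and its complement.
  refine ⟨Prop, Prop, inferInstance, inferInstance, (· ∈ A), (· ∈ B), {(True, True)},
    fun i => ?_, fun j => ?_, ?_⟩
  · exact (measurable_mem.2 hA) (MeasurableSet.of_discrete)
  · exact (measurable_mem.2 hB) (MeasurableSet.of_discrete)
  · ext q
    simp

theorem isSetAlgebra_rectAlgebra : IsSetAlgebra (rectAlgebra S T) where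
  empty_mem := by
    simpa using prod_mem_rectAlgebra (MeasurableSet.empty : MeasurableSet (∅ : Set S))
      (MeasurableSet.empty : MeasurableSet (∅ : Set T))
  compl_mem := by
    rintro _ ⟨I, J, hI, hJ, a, b, G, ha, hb, rfl⟩
    exact ⟨I, J, hI, hJ, a, b, Gᶜ, ha, hb, rfl⟩
  union_mem := by
    rintro _ _ ⟨I, J, _, _, a, b, G, ha, hb, rfl⟩ ⟨I', J', _, _, a', b', G', ha', hb', rfl⟩
    -- Pairs of labels describe the common refinement of the two partitions.
    refine ⟨I × I', J × J', inferInstance, inferInstance, fun x => (a x, a' x),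
      fun y => (b y, b' y), {k | (k.1.1, k.2.1) ∈ G ∨ (k.1.2, k.2.2) ∈ G'}, fun i => ?_,
      fun j => ?_, rfl⟩
    · convert (ha i.1).inter (ha' i.2) using 1
      ext x
      simp [Prod.ext_iff]
    · convert (hb j.1).inter (hb' j.2) using 1
      ext x
      simp [Prod.ext_iff]

theorem measureDense_rectAlgebra (μ : Measure S) (ν : Measure T) [SigmaFinite μ] [SigmaFinite ν] :
    (μ.prod ν).MeasureDense (rectAlgebra S T) := by
  have hsub : image2 (· ×ˢ ·) {A : Set S | MeasurableSet A} {B : Set T | MeasurableSet B} ⊆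
      rectAlgebra S T := by
    rintro _ ⟨A, hA, B, hB, rfl⟩
    exact prod_mem_rectAlgebra hA hB
  refine .of_generateFrom_isSetAlgebra_sigmaFinite isSetAlgebra_rectAlgebra
    ((μ.toFiniteSpanningSetsIn.prod ν.toFiniteSpanningSetsIn).mono hsub) (le_antisymm ?_ ?_)
  · rw [← generateFrom_prod]
    exact MeasurableSpace.generateFrom_mono hsub
  · exact MeasurableSpace.generateFrom_le fun C hC => measurableSet_of_mem_rectAlgebra hC

theorem generateFrom_measurableSet_lt_top (μ : Measure S) [SigmaFinite μ] :
    MeasurableSpace.generateFrom {A | MeasurableSet A ∧ μ A < ∞} = ‹MeasurableSpace S› := by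
  refine le_antisymm (MeasurableSpace.generateFrom_le fun A hA => hA.1) fun A hA => ?_
  have : A = ⋃ n, A ∩ spanningSets μ n := by
    rw [← inter_iUnion, iUnion_spanningSets, inter_univ]
  rw [this]
  refine MeasurableSet.iUnion fun n => MeasurableSpace.measurableSet_generateFrom
    ⟨hA.inter (measurableSet_spanningSets μ n), ?_⟩
  exact (measure_mono inter_subset_right).trans_lt (measure_spanningSets_lt_top μ n)

theorem isPiSystem_measurableSet_lt_top (μ : Measure S) :
    IsPiSystem {A | MeasurableSet A ∧ μ A < ∞} := fun _ hA _ hB _ =>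
  ⟨hA.1.inter hB.1, (measure_mono inter_subset_left).trans_lt hA.2⟩

/-- Two `σ`-finite factors determine their product on rectangles with sides of finite measure. -/
theorem prod_eq_of_forall_lt_top {μ : Measure S} {ν : Measure T} [SigmaFinite μ] [SigmaFinite ν]
    {ρ : Measure (S × T)}
    (h : ∀ A B, MeasurableSet A → MeasurableSet B → μ A < ∞ → ν B < ∞ → ρ (A ×ˢ B) = μ A * ν B) :
    μ.prod ν = ρ := by
  refine Measure.prod_eq_generateFrom (generateFrom_measurableSet_lt_top μ)
    (generateFrom_measurableSet_lt_top ν) (isPiSystem_measurableSet_lt_top μ)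
    (isPiSystem_measurableSet_lt_top ν)
    ⟨spanningSets μ, fun n => ⟨measurableSet_spanningSets μ n, measure_spanningSets_lt_top μ n⟩,
      measure_spanningSets_lt_top μ, iUnion_spanningSets μ⟩
    ⟨spanningSets ν, fun n => ⟨measurableSet_spanningSets ν n, measure_spanningSets_lt_top ν n⟩,
      measure_spanningSets_lt_top ν, iUnion_spanningSets ν⟩ ?_
  exact fun A hA B hB => h A B hA.1 hB.1 hA.2 hB.2

end RectAlgebra

/-! ### White noise has the Poisson characteristic functional -/

section WhiteNoise

variable {Ω : Type*} [mΩ : MeasurableSpace Ω] {P : Measure Ω}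
  {S : Type*} [MeasurableSpace S] {σ : Measure S} [SigmaFinite σ] {ν : Measure ℝ} [SigmaFinite ν]
  {η : Ω → Measure (S × ℝ)}

/-- A Poissonian white noise as a kernel. -/
def IsPoissonianWhiteNoise.kernel (hη : IsPoissonianWhiteNoise P σ ν η) : Kernel Ω (S × ℝ) :=
  ⟨η, hη.measurable⟩

/-- A Poisson variable has its parameter as mean, so `E η` agrees with `σ ⊗ ν` on rectangles with
sides of finite measure; these determine the product. -/
theorem IsPoissonianWhiteNoise.bind_kernel (hη : IsPoissonianWhiteNoise P σ ν η) :
    P.bind hη.kernel = σ.prod ν := by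
  refine (prod_eq_of_forall_lt_top fun A B hA hB hA' hB' => ?_).symm
  have hfin : σ A * ν B < ∞ := ENNReal.mul_lt_top hA' hB'
  rw [Measure.bind_apply (hA.prod hB) hη.kernel.aemeasurable]
  exact (hη.poisson A B hA hB hfin).lintegral_eq (Kernel.measurable_coe hη.kernel (hA.prod hB))
    hfin.ne

variable [IsProbabilityMeasure P]

theorem IsPoissonianWhiteNoise.hasPoissonCharFun_rectAlgebra
    (hη : IsPoissonianWhiteNoise P σ ν η) {ι : Type} [Fintype ι] (t : ι → ℝ)
    {D : ι → Set (S × ℝ)} (hD : ∀ i, D i ∈ rectAlgebra S ℝ)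
    (hfin : ∀ i, (σ.prod ν) (D i) ≠ ∞) :
    HasPoissonCharFun P hη.kernel (σ.prod ν) fun x => ∑ i, (D i).indicator (fun _ => t i) x := by
  classical
  choose I J fI fJ a b G ha hb hG using hD
  let A : S → ∀ i, I i := fun x i => a i x
  let B : ℝ → ∀ i, J i := fun y i => b i y
  -- Only cells of the common refinement contained in some `D i` are kept. They inherit finite
  -- intensity; the discarded cells may have infinite intensity but the simple function vanishes
  -- there.
  let K : Type := {k : (∀ i, I i) × (∀ i, J i) // ∃ i, (k.1 i, k.2 i) ∈ G i}
  have : Fintype K := Fintype.ofFinite K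
  let R : K → Set (S × ℝ) := fun k => (A ⁻¹' {k.1.1}) ×ˢ (B ⁻¹' {k.1.2})
  have hA : ∀ α, MeasurableSet (A ⁻¹' {α}) := fun α => by
    rw [show A ⁻¹' {α} = ⋂ i, a i ⁻¹' {α i} by ext; simp [A, funext_iff]]
    exact MeasurableSet.iInter fun i => ha i _
  have hB : ∀ β, MeasurableSet (B ⁻¹' {β}) := fun β => by
    rw [show B ⁻¹' {β} = ⋂ i, b i ⁻¹' {β i} by ext; simp [B, funext_iff]]
    exact MeasurableSet.iInter fun i => hb i _
  have hR : ∀ k, MeasurableSet (R k) := fun k => (hA _).prod (hB _)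
  have hRfin : ∀ k, (σ.prod ν) (R k) ≠ ∞ := by
    rintro ⟨k, i, hi⟩
    refine ((measure_mono ?_).trans_lt (hfin i).lt_top).ne
    rintro ⟨x, y⟩ ⟨hx, hy⟩
    rw [hG]
    have h1 : A x = k.1 := hx
    have h2 : B y = k.2 := hy
    rw [← h1, ← h2] at hi
    exact hi
  have hRdisj : Pairwise fun k l => Disjoint (R k) (R l) := by
    intro k l hkl
    refine Set.disjoint_left.2 fun q hq hq' => hkl (Subtype.ext (Prod.ext ?_ ?_))
    · exact hq.1.symm.trans hq'.1
    · exact hq.2.symm.trans hq'.2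
  have hind : iIndepFun (fun k ω => hη.kernel ω (R k)) P := by
    let e := (Finite.equivFin K).symm
    refine (iIndepFun_precomp_of_bijective (g := e) e.bijective).1 ?_
    exact hη.indep _ (fun n => A ⁻¹' {(e n).1.1}) (fun n => B ⁻¹' {(e n).1.2}) (fun n => hA _)
      (fun n => hB _) fun n m hnm => hRdisj (e.injective.ne hnm)
  have hpois : ∀ k, IsPoissonVar P (fun ω => hη.kernel ω (R k)) ((σ.prod ν) (R k)) := by
    intro k
    have := hRfin k
    rw [Measure.prod_prod] at this ⊢
    exact hη.poisson _ _ (hA _) (hB _) this.lt_top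
  -- On a cell the simple function is constant, equal to the sum of the `t i` with the cell inside
  -- `D i`.
  have key := hasPoissonCharFun_of_iIndepFun hη.bind_kernel hR hRfin hRdisj hind hpois
    fun k => ∑ i, if (k.1.1 i, k.1.2 i) ∈ G i then t i else 0
  convert key using 2 with q
  have hterm : ∀ i, (D i).indicator (fun _ => t i) q =
      if (A q.1 i, B q.2 i) ∈ G i then t i else 0 := by
    intro i
    rw [indicator_apply, hG]
    rfl
  simp_rw [hterm]
  by_cases hq : ∃ i, (A q.1 i, B q.2 i) ∈ G i
  · rw [Finset.sum_eq_single (⟨(A q.1, B q.2), hq⟩ : K)]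
    · rw [indicator_of_mem (show q ∈ R ⟨(A q.1, B q.2), hq⟩ from ⟨rfl, rfl⟩)]
    · intro k _ hk
      refine indicator_of_notMem (fun hqk => hk (Subtype.ext (Prod.ext ?_ ?_))) _
      · exact hqk.1.symm
      · exact hqk.2.symm
    · simp
  · rw [Finset.sum_eq_zero fun i _ => if_neg fun h => hq ⟨i, h⟩, Finset.sum_eq_zero fun k _ => ?_]
    refine indicator_of_notMem (fun hqk => hq ?_) _
    obtain ⟨k, i, hi⟩ := k
    have h1 : A q.1 = k.1 := hqk.1
    have h2 : B q.2 = k.2 := hqk.2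
    rw [← h1, ← h2] at hi
    exact ⟨i, hi⟩

theorem IsPoissonianWhiteNoise.hasPoissonCharFunctional (hη : IsPoissonianWhiteNoise P σ ν η) :
    HasPoissonCharFunctional P hη.kernel (σ.prod ν) := fun _ _ hC hfin t =>
  hasPoissonCharFun_sum_indicator_of_measureDense hη.bind_kernel (measureDense_rectAlgebra σ ν) t
    (fun _ hD hDfin => hη.hasPoissonCharFun_rectAlgebra t hD hDfin) hC hfin

end WhiteNoise

/-! ### Space-time noise, filtrations and the image measure -/

section SpaceTime

theorem sigmaFinite_comap {α β : Type*} [MeasurableSpace α] [MeasurableSpace β] {f : α → β}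
    (hf : MeasurableEmbedding f) (μ : Measure β) [SigmaFinite μ] : SigmaFinite (μ.comap f) := by
  refine SigmaFinite.of_map _ hf.measurable.aemeasurable ?_
  rw [hf.map_comap]
  infer_instance

theorem measurableEmbedding_coe_nnreal : MeasurableEmbedding ((↑) : ℝ≥0 → ℝ) :=
  MeasurableEmbedding.subtype_coe measurableSet_Ici

instance : SigmaFinite timeMeasure :=
  sigmaFinite_comap measurableEmbedding_coe_nnreal volume

theorem timeMeasure_singleton (t : ℝ≥0) : timeMeasure {t} = 0 := by
  rw [timeMeasure, measurableEmbedding_coe_nnreal.comap_apply]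
  simp

theorem sigmaFinite_spaceMeasure {d : ℕ} {O : Set (EuclideanSpace ℝ (Fin d))}
    (hO : MeasurableSet O) : SigmaFinite (spaceMeasure O) :=
  sigmaFinite_comap (MeasurableEmbedding.subtype_coe hO) volume

variable {Ω : Type*} {X : Type*} [MeasurableSpace X] {Z : Type*} [MeasurableSpace Z]
  {J : X × ℝ → Z}

theorem noiseProcess_apply (η : Ω → Measure ((X × ℝ≥0) × ℝ)) (t : ℝ≥0) (ω : Ω) {A : Set (X × ℝ)}
    (hA : MeasurableSet A) :
    noiseProcess η t ω A = η ω {q | (q.1.1, q.2) ∈ A ∧ q.1.2 < t} := by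
  have hm : Measurable fun q : (X × ℝ≥0) × ℝ => (q.1.1, q.2) := by fun_prop
  rw [noiseProcess, Measure.map_apply hm hA, Measure.restrict_apply (hm hA)]
  rfl

theorem measurable_jumpMap (hJ : Measurable J) :
    Measurable fun q : (X × ℝ≥0) × ℝ => (J (q.1.1, q.2), q.1.2) := by fun_prop

theorem pushNoise_apply (hJ : Measurable J) (η : Ω → Measure ((X × ℝ≥0) × ℝ)) (ω : Ω)
    {C : Set (Z × ℝ≥0)} (hC : MeasurableSet C) :
    pushNoise J η ω C = η ω ((fun q => (J (q.1.1, q.2), q.1.2)) ⁻¹' C) :=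
  Measure.map_apply (measurable_jumpMap hJ) hC

theorem pushNoise_prod_eq_lintegral (hJ : Measurable J) (η : Ω → Measure ((X × ℝ≥0) × ℝ)) (ω : Ω)
    {B : Set Z} {I : Set ℝ≥0} (hB : MeasurableSet B) (hI : MeasurableSet I) :
    pushNoise J η ω (B ×ˢ I) =
      ∫⁻ q, I.indicator 1 q.1.2 * B.indicator 1 (J (q.1.1, q.2)) ∂(η ω) := by
  rw [pushNoise_apply hJ η ω (hB.prod hI),
    ← lintegral_indicator_one (measurable_jumpMap hJ (hB.prod hI))]
  congr 1 with q
  by_cases h1 : J (q.1.1, q.2) ∈ B <;> by_cases h2 : q.1.2 ∈ I <;> simp [h1, h2]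

theorem measurePreserving_prod_right_comm {α β γ : Type*} [MeasurableSpace α] [MeasurableSpace β]
    [MeasurableSpace γ] (μ : Measure α) (τ : Measure β) (ν : Measure γ) [SFinite μ] [SFinite τ]
    [SFinite ν] :
    MeasurePreserving (fun q : (α × β) × γ => ((q.1.1, q.2), q.1.2)) ((μ.prod τ).prod ν)
      ((μ.prod ν).prod τ) :=
  ((measurePreserving_prodAssoc μ ν τ).symm _).comp
    (((MeasurePreserving.id μ).prod Measure.measurePreserving_swap).comp
      (measurePreserving_prodAssoc μ τ ν))

variable [mΩ : MeasurableSpace Ω] {P : Measure Ω} [IsProbabilityMeasure P] {μ : Measure X}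
  [SigmaFinite μ] {ν : Measure ℝ} [SigmaFinite ν] {η : Ω → Measure ((X × ℝ≥0) × ℝ)}

/-- A Poissonian space-time white noise is a noise over its completed natural filtration. -/
theorem IsPoissonianWhiteNoise.isNoiseOver_noiseFiltration [P.IsComplete]
    (hη : IsPoissonianWhiteNoise P (μ.prod timeMeasure) ν η) :
    IsNoiseOver P (noiseFiltration P η hη.measurable) η where
  adapted t := (comap_measurable (noiseProcess η t)).mono
    ((le_iSup₂ (f := fun s (_ : s ≤ t) => MeasurableSpace.comap (noiseProcess η s) inferInstance)
      t le_rfl).trans le_sup_left) le_rfl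
  indep_past D hD s t _ := by
    have hJ : Measurable fun q : (X × ℝ≥0) × ℝ => (q.1.1, q.2) := by fun_prop
    have hT : Measurable fun q : (X × ℝ≥0) × ℝ => q.1.2 := by fun_prop
    have hH : MeasurableSet {q : (X × ℝ≥0) × ℝ | (q.1.1, q.2) ∈ D ∧ q.1.2 ∈ Ioc s t} :=
      (hJ hD).inter (hT measurableSet_Ioc)
    -- Up to null sets, the past at time `s` is generated by values of `η` on sets with time in `[0,
    -- u)`, `u ≤ s`, all disjoint from the slab `(s, t]`.
    refine (indep_of_indep_of_le_left (indep_sup_generateFrom_null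
      (hη.hasPoissonCharFunctional.indep_disjoint hη.bind_kernel hH)) ?_).symm
    refine sup_le_sup (iSup₂_le fun u hu => Measurable.comap_le ?_) le_rfl
    refine Measure.measurable_of_measurable_coe _ fun A hA => ?_
    simp_rw [noiseProcess_apply η u _ hA]
    have hG : MeasurableSet {q : (X × ℝ≥0) × ℝ | (q.1.1, q.2) ∈ A ∧ q.1.2 < u} :=
      (hJ hA).inter (hT measurableSet_Iio)
    have hGH : Disjoint {q : (X × ℝ≥0) × ℝ | (q.1.1, q.2) ∈ A ∧ q.1.2 < u}
        {q | (q.1.1, q.2) ∈ D ∧ q.1.2 ∈ Ioc s t} :=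
      Set.disjoint_left.2 fun q hq hq' => ((hq.2.trans_le hu).trans hq'.2.1).false
    refine (comap_measurable fun ω => η ω _).mono ?_ le_rfl
    exact le_iSup (fun G : {G : Set ((X × ℝ≥0) × ℝ) // MeasurableSet G ∧ Disjoint G
      {q | (q.1.1, q.2) ∈ D ∧ q.1.2 ∈ Ioc s t}} =>
        MeasurableSpace.comap (fun ω => hη.kernel ω G.1) inferInstance) ⟨_, hG, hGH⟩

/-- The image of a Poissonian space-time white noise is a time homogeneous Poisson random measure
over every complete filtration that is compatible with the noise. -/
theorem IsPoissonianWhiteNoise.isTimeHomogeneousPRM_pushNoise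
    (hη : IsPoissonianWhiteNoise P (μ.prod timeMeasure) ν η) (hJ : Measurable J)
    {𝓕 : Filtration ℝ≥0 mΩ} (hnull : ∀ A, P A = 0 → MeasurableSet[𝓕 0] A)
    (hN : IsNoiseOver P 𝓕 η) :
    IsTimeHomogeneousPRM P 𝓕 ((μ.prod ν).map J) (pushNoise J η) := by
  have hΦ := measurable_jumpMap hJ
  have hmean : ∀ C : Set (Z × ℝ≥0), MeasurableSet C → ∫⁻ ω, pushNoise J η ω C ∂P =
      ((μ.prod timeMeasure).prod ν) ((fun q => (J (q.1.1, q.2), q.1.2)) ⁻¹' C) := by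
    intro C hC
    rw [← hη.bind_kernel, Measure.bind_apply (hΦ hC) hη.kernel.aemeasurable]
    exact lintegral_congr fun ω => pushNoise_apply hJ η ω hC
  refine ⟨⟨(Measure.measurable_map _ hΦ).comp hη.measurable, fun ω B hB => ?_, fun B hB => ?_,
    fun n B hB hdisj => ?_, fun U hU t => ?_, fun U hU s t hst => ?_⟩, fun A I hA hI => ?_⟩
  · rw [pushNoise_apply hJ η ω hB]
    exact hη.integerValued ω _ (hΦ hB)
  · rw [hmean B hB]
    simp_rw [pushNoise_apply hJ η _ hB]
    exact hη.hasPoissonCharFunctional.isPoissonVar hη.bind_kernel (hΦ hB)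
  · simp_rw [pushNoise_apply hJ η _ (hB _)]
    exact hη.hasPoissonCharFunctional.iIndepFun hη.bind_kernel (fun i => hΦ (hB i))
      fun i j hij => (hdisj hij).preimage _
  -- The image measure counts times in `(0, t]` but `Π(t)` counts times in `[0, t)`. The slices at
  -- `0` and `t` have intensity zero, so almost surely carry no points, and completeness of the
  -- filtration absorbs the exceptional null set.
  · have hzero : ∀ r : ℝ≥0, ∀ᵐ ω ∂P, ∀ᵐ q ∂η ω, q.1.2 ≠ r := by
      intro r
      refine Measure.ae_ae_of_ae_bind hη.measurable.aemeasurable ?_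
      rw [show P.bind η = _ from hη.bind_kernel, ae_iff]
      have : {q : (X × ℝ≥0) × ℝ | ¬ q.1.2 ≠ r} = (univ ×ˢ {r}) ×ˢ univ := by
        ext q
        simp
      rw [this, Measure.prod_prod, Measure.prod_prod, timeMeasure_singleton, mul_zero, zero_mul]
    have hmeas : Measurable[𝓕 t] fun ω => noiseProcess η t ω (J ⁻¹' U) :=
      (Measure.measurable_coe (hJ hU)).comp (hN.adapted t)
    refine measurable_of_ae_eq (P := P) (fun A hA => 𝓕.mono zero_le A (hnull A hA)) hmeas ?_
    filter_upwards [hzero 0, hzero t] with ω h0 ht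
    rw [pushNoise_apply hJ η ω (hU.prod measurableSet_Ioc), noiseProcess_apply η t ω (hJ hU)]
    refine measure_congr ?_
    filter_upwards [h0, ht] with q hq0 hqt
    refine propext (and_congr_right fun _ => ?_)
    exact ⟨fun h => lt_of_le_of_ne h.2 hqt, fun h => ⟨pos_iff_ne_zero.2 hq0, le_of_lt h⟩⟩
  · simp_rw [pushNoise_apply hJ η _ (hU.prod measurableSet_Ioc)]
    exact hN.indep_past (J ⁻¹' U) (hJ hU) s t hst
  · rw [hmean _ (hA.prod hI), Measure.map_apply hJ hA, ← Measure.prod_prod,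
      ← (measurePreserving_prod_right_comm μ timeMeasure ν).measure_preimage
        ((hJ hA).prod hI).nullMeasurableSet]
    rfl

end SpaceTime

end PoissonBesov

end

/-! ### The main theorem -/

theorem mainTheorem10 (d : ℕ) (hd : 1 ≤ d) (O : Set (EuclideanSpace ℝ (Fin d)))
    (hO : PoissonBesov.IsSmoothBoundedDomain O) (p : ℝ) (hp1 : 1 < p) (hp2 : p ≤ 2)
    (ψ : EuclideanSpace ℝ (Fin d) → ℝ) (hψ : PoissonBesov.IsCutoff ψ)
    (ν : Measure ℝ) (hν : PoissonBesov.IsLevyMeasure ν)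
    {Ω : Type*} [mΩ : MeasurableSpace Ω] (P : Measure Ω) [IsProbabilityMeasure P] [P.IsComplete]
    (η : Ω → Measure ((O × ℝ≥0) × ℝ))
    (hη : PoissonBesov.IsPoissonianWhiteNoise P
      ((PoissonBesov.spaceMeasure O).prod PoissonBesov.timeMeasure) ν η) :
    ∃ J : O × ℝ → PoissonBesov.BesovSpace ψ ((d : ℝ) / p - d) (ENNReal.ofReal p) O,
      (∀ (ξ : O) (ζ : ℝ), (J (ξ, ζ)).val =
        (ζ : ℂ) • TemperedDistribution.delta (ξ : EuclideanSpace ℝ (Fin d))) ∧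
      Measurable J ∧
      (∀ ω B I, MeasurableSet B → MeasurableSet I →
        PoissonBesov.pushNoise J η ω (B ×ˢ I) =
          ∫⁻ q, I.indicator 1 q.1.2 * B.indicator 1 (J (q.1.1, q.2)) ∂(η ω)) ∧
      ∃ νhat : Measure (PoissonBesov.BesovSpace ψ ((d : ℝ) / p - d) (ENNReal.ofReal p) O),
        (∀ B, MeasurableSet B →
          νhat B = ∫⁻ ζ, ∫⁻ ξ : O, B.indicator 1 (J (ξ, ζ)) ∂(PoissonBesov.spaceMeasure O) ∂ν) ∧
        PoissonBesov.IsTimeHomogeneousPRM P (PoissonBesov.noiseFiltration P η hη.measurable) νhat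
          (PoissonBesov.pushNoise J η) ∧
        ∀ 𝓕 : Filtration ℝ≥0 mΩ, (∀ A, P A = 0 → MeasurableSet[𝓕 0] A) →
          PoissonBesov.IsNoiseOver P 𝓕 η →
            PoissonBesov.IsTimeHomogeneousPRM P 𝓕 νhat (PoissonBesov.pushNoise J η) := by
  have := hν.sigmaFinite
  have := PoissonBesov.sigmaFinite_spaceMeasure hO.isOpen.measurableSet
  have hp : 0 < p := one_pos.trans hp1
  have hJ := PoissonBesov.measurable_pointMass (O := O) hψ hp
  refine ⟨PoissonBesov.pointMass O hψ hp, fun _ _ => rfl, hJ,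
    fun ω _ _ hB hI => PoissonBesov.pushNoise_prod_eq_lintegral hJ η ω hB hI,
    ((PoissonBesov.spaceMeasure O).prod ν).map (PoissonBesov.pointMass O hψ hp),
    fun B hB => ?_, ?_, fun _ hnull hN => hη.isTimeHomogeneousPRM_pushNoise hJ hnull hN⟩
  -- Tonelli with the jump size as outer variable turns the image of the product measure into the
  -- stated iterated integral.
  · rw [Measure.map_apply hJ hB, Measure.prod_apply_symm (hJ hB)]
    refine lintegral_congr fun ζ => ?_
    rw [← lintegral_indicator_one (measurable_prodMk_right (hJ hB))]
    rfl
  · refine hη.isTimeHomogeneousPRM_pushNoise hJ (fun A hA => ?_) hη.isNoiseOver_noiseFiltration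
    exact le_sup_right (a := ⨆ s : ℝ≥0, ⨆ _ : s ≤ 0,
      MeasurableSpace.comap (PoissonBesov.noiseProcess η s) inferInstance) A
      (MeasurableSpace.measurableSet_generateFrom hA)
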